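/- Let $G$ be a compact connected simple Lie group with Lie algebra $\mathfrak g$, let $S\subset G$ be a torus, $K=C_G(S)$ its centralizer (so that $M=G/K$ is a generalized flag manifold), $\mathfrak k$ the Lie algebra of $K$, $\varphi$ the Killing form of $\mathfrak g$, $(\cdot,\cdot)=-\varphi$, and $\mathfrak m=\mathfrak k^{\perp}$. Let $\mathfrak h\subset\mathfrak k$ be a maximal abelian subalgebra of $\mathfrak g$, $R\subset(\mathfrak h^{\mathbb C})^*$ the root system of $\mathfrak g^{\mathbb C}$ with root spaces $\mathfrak g_\alpha$, $R_K=\{\alpha\in R:\mathfrak g_\alpha\subset\mathfrak k^{\mathbb C}\}$ and $R_M=R\setminus R_K$. Let $\mathfrak t=Z(\mathfrak k)$ be the center of $\mathfrak k$, $\kappa(\alpha)=\alpha|_{\mathfrak t}$, and $R_{\mathfrak t}=\kappa(R_M)$ the set of $\mathfrak t$-roots. For $\xi\in R_{\mathfrak t}$ put $\mathfrak m_\xi=\sum_{\alpha\in R_M,\,\kappa(\alpha)=\xi}\mathfrak g_\alpha$, and let $\tau$ be the complex conjugation of $\mathfrak g^{\mathbb C}$ with respect to $\mathfrak g$. Let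 $\mathfrak m=\mathfrak m_1\oplus\cdots\oplus\mathfrak m_s$ be a $(\cdot,\cdot)$-orthogonal decomposition into pairwise inequivalent irreducible $\operatorname{ad}(\mathfrak k)$-modules. Say that $\xi\in R_{\mathfrak t}$ corresponds to $\mathfrak m_i$ if $\mathfrak m_i=(\mathfrak m_\xi\oplus\mathfrak m_{-\xi})^{\tau}$. Then: (1) for every $i$ there is a $\mathfrak t$-root $\xi$ such that the $\mathfrak t$-roots corresponding to $\mathfrak m_i$ are exactly $\xi$ and $-\xi$; (2) the de Siebenthal invariant $\mathcal T=\{(i,j,k):([\mathfrak m_i,\mathfrak m_j],\mathfrak m_k)\neq0\}$ is $$\mathcal T=\{(i,j,k): \xi_i+\xi_j+\xi_k=0 \text{ for some } \mathfrak t\text{-roots } \xi_i,\xi_j,\xi_k \text{ corresponding to } \mathfrak m_i,\mathfrak m_j,\mathfrak m_k \text{ respectively}\};$$ (3) three $\mathfrak t$-roots with sum $0$ never all have the same sign: if $R_M^+\subset R_M$ is an invariant ordering (that is, $R_M=R_M^+\sqcup(-R_M^+)$; $\alpha,\beta\in R_M^+$ and $\alpha+\beta\in R_M$ imply $\alpha+\beta\in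 R_M^+$; $\alpha\in R_M^+$, $\beta\in R_K$ and $\alpha+\beta\in R$ imply $\alpha+\beta\in R_M^+$), then the three $\mathfrak t$-roots do not all lie in $\kappa(R_M^+)$ and do not all lie in $\kappa(-R_M^+)$. -/

import Mathlib

open scoped Manifold ContDiff TensorProduct

noncomputable section

/-! ### Tori and Lie algebras of subgroups of a Lie group -/

section Group

variable {E : Type*} [NormedAddCommGroup E] [NormedSpace ℝ E]
  {G : Type*} [TopologicalSpace G] [ChartedSpace E G] [Group G]

instance lieGroup_minSmoothness_three [LieGroup 𝓘(ℝ, E) ∞ G] :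
    LieGroup 𝓘(ℝ, E) (minSmoothness ℝ 3) G := by
  rw [minSmoothness_of_isRCLikeNormedField]
  infer_instance

/-- A subgroup `S` of a Lie group `G` is a torus if it is the image of an injective homomorphism of
Lie groups `ℝⁿ / ℤⁿ → G`, i.e. the image of a smooth homomorphism `ℝⁿ → G` with kernel `ℤⁿ`. -/
def IsTorus (S : Subgroup G) : Prop :=
  ∃ (n : ℕ) (f : (Fin n → ℝ) → G),
    ContMDiff 𝓘(ℝ, Fin n → ℝ) 𝓘(ℝ, E) ∞ f ∧
    (∀ v w, f (v + w) = f v * f w) ∧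
    (∀ v, f v = 1 ↔ ∀ i, ∃ m : ℤ, v i = m) ∧
    Set.range f = (S : Set G)

/-- `X` is the initial velocity of a smooth one-parameter subgroup of `G` that lies in `K`. -/
def IsOneParameterVelocity (K : Subgroup G) (X : GroupLieAlgebra 𝓘(ℝ, E) G) : Prop :=
  ∃ γ : ℝ → G,
    ContMDiff 𝓘(ℝ, ℝ) 𝓘(ℝ, E) ∞ γ ∧
    (∀ a b, γ (a + b) = γ a * γ b) ∧
    (∀ a, γ a ∈ K) ∧
    tangentMap 𝓘(ℝ, ℝ) 𝓘(ℝ, E) γ ⟨0, (1 : ℝ)⟩ = ⟨1, X⟩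

/-- The Lie algebra of a (closed) subgroup `K` of a Lie group: it consists of the initial velocities
of the one-parameter subgroups lying in `K`. (For a closed subgroup these velocities already form a
Lie subalgebra; taking the Lie span only packages the set as a Lie subalgebra.) -/
def Subgroup.lieAlgebra [LieGroup 𝓘(ℝ, E) (minSmoothness ℝ 3) G] [CompleteSpace E]
    (K : Subgroup G) : LieSubalgebra ℝ (GroupLieAlgebra 𝓘(ℝ, E) G) :=
  LieSubalgebra.lieSpan ℝ (GroupLieAlgebra 𝓘(ℝ, E) G) {X | IsOneParameterVelocity K X}

end Group

/-! ### Roots, complementary roots and `𝔱`-roots -/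

namespace FlagManifold

variable {L : Type*} [LieRing L] [LieAlgebra ℝ L]

/-- The centre `𝔱 = Z(𝔨)` of a Lie subalgebra `𝔨`, as a subspace of the ambient Lie algebra. -/
def centre (𝔨 : LieSubalgebra ℝ L) : Submodule ℝ L :=
  (LieAlgebra.center ℝ 𝔨).toSubmodule.map (𝔨.toSubmodule.subtype)

/-- A maximal abelian subalgebra `𝔥` of the ambient Lie algebra that is contained in `𝔨`
(for compact groups: the Lie algebra of a maximal torus contained in the subgroup). -/
structure MaximalAbelianIn (𝔨 : LieSubalgebra ℝ L) where
  /-- the subalgebra -/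
  𝔥 : LieSubalgebra ℝ L
  le : 𝔥 ≤ 𝔨
  abelian : ∀ X ∈ 𝔥, ∀ Y ∈ 𝔥, ⁅X, Y⁆ = 0
  maximal : ∀ X : L, (∀ Y ∈ 𝔥, ⁅X, Y⁆ = 0) → X ∈ 𝔥

variable {𝔨 : LieSubalgebra ℝ L} (A : MaximalAbelianIn 𝔨)

theorem centre_le : centre 𝔨 ≤ A.𝔥.toSubmodule := by
  rintro _ ⟨X, hX, rfl⟩
  refine A.maximal _ fun Y hY => ?_
  have h := (LieModule.mem_maxTrivSubmodule (R := ℝ) (L := 𝔨) (M := 𝔨) X).1 hX ⟨Y, A.le hY⟩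
  have h' : ⁅Y, (X : L)⁆ = 0 := by simpa using congrArg Subtype.val h
  change ⁅(X : L), Y⁆ = 0
  rw [← lie_skew, h', neg_zero]

/-- The complexification `𝔥^ℂ`, as a complex subspace of `𝔤^ℂ = ℂ ⊗ 𝔤`. -/
abbrev MaximalAbelianIn.complexified (A : MaximalAbelianIn 𝔨) : Submodule ℂ (ℂ ⊗[ℝ] L) :=
  A.𝔥.toSubmodule.baseChange ℂ

/-- The inclusion of `𝔱 = Z(𝔨)` into `𝔥^ℂ`, `H ↦ 1 ⊗ H`. -/
def centreIncl : centre 𝔨 →ₗ[ℝ] A.complexified where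
  toFun H := ⟨1 ⊗ₜ (H : L), Submodule.tmul_mem_baseChange_of_mem 1 (centre_le A H.2)⟩
  map_add' H H' := by ext; simp [TensorProduct.tmul_add]
  map_smul' c H := by ext; simp [TensorProduct.tmul_smul]

/-- The space `𝔤_α = {X ∈ 𝔤^ℂ : [H, X] = α(H) X for all H ∈ 𝔥^ℂ}`. -/
def rootSpace (α : Module.Dual ℂ A.complexified) : Submodule ℂ (ℂ ⊗[ℝ] L) :=
  ⨅ H : A.complexified,
    Module.End.eigenspace (LieAlgebra.ad ℂ (ℂ ⊗[ℝ] L) (H : ℂ ⊗[ℝ] L)) (α H)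

/-- The root system `R` of `𝔤^ℂ` relative to `𝔥^ℂ`. -/
def roots : Set (Module.Dual ℂ A.complexified) :=
  {α | α ≠ 0 ∧ rootSpace A α ≠ ⊥}

/-- The roots `R_K` of `𝔨^ℂ`: those whose root space lies in `𝔨^ℂ`. -/
def isotropyRoots : Set (Module.Dual ℂ A.complexified) :=
  {α | α ∈ roots A ∧ rootSpace A α ≤ 𝔨.toSubmodule.baseChange ℂ}

/-- The complementary roots `R_M = R ∖ R_K`. -/
def complementaryRoots : Set (Module.Dual ℂ A.complexified) :=
  roots A \ isotropyRoots A

/-- The restriction map `κ(α) = α|_𝔱`. As `𝔱` is the centre of the real Lie algebra `𝔨`, the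
restrictions of roots take purely imaginary values. -/
def kappa (α : Module.Dual ℂ A.complexified) : centre 𝔨 →ₗ[ℝ] ℂ :=
  α.restrictScalars ℝ ∘ₗ centreIncl A

/-- The set `R_𝔱 = κ(R_M)` of `𝔱`-roots. -/
def tRoots : Set (centre 𝔨 →ₗ[ℝ] ℂ) :=
  kappa A '' complementaryRoots A

/-- The module `𝔪_ξ = ∑_{α ∈ R_M, κ(α) = ξ} 𝔤_α`. -/
def tRootModule (ξ : centre 𝔨 →ₗ[ℝ] ℂ) : Submodule ℂ (ℂ ⊗[ℝ] L) :=
  ⨆ α ∈ {α | α ∈ complementaryRoots A ∧ kappa A α = ξ}, rootSpace A α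

/-- For a complex subspace `N` of `𝔤^ℂ`, the space `N^τ` of the elements of `N` fixed by the
complex conjugation `τ` of `𝔤^ℂ` with respect to `𝔤`, seen as a real subspace of `𝔤`
(the fixed points of `τ` in `𝔤^ℂ` are the `1 ⊗ X` with `X ∈ 𝔤`). -/
def realPoints (N : Submodule ℂ (ℂ ⊗[ℝ] L)) : Submodule ℝ L :=
  (N.restrictScalars ℝ).comap (TensorProduct.mk ℝ ℂ L 1)

/-- The `𝔱`-root `ξ` corresponds to the real submodule `𝔫`: `𝔫 = (𝔪_ξ ⊕ 𝔪_{-ξ})^τ`. -/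
def Corresponds (ξ : centre 𝔨 →ₗ[ℝ] ℂ) (𝔫 : LieSubmodule ℝ 𝔨 L) : Prop :=
  ξ ∈ tRoots A ∧ 𝔫.toSubmodule = realPoints (tRootModule A ξ ⊔ tRootModule A (-ξ))

/-- An invariant ordering `R_M^+` in `R_M`. -/
structure IsInvariantOrdering (P : Set (Module.Dual ℂ A.complexified)) : Prop where
  union_neg : P ∪ -P = complementaryRoots A
  disjoint_neg : Disjoint P (-P)
  add_mem : ∀ α ∈ P, ∀ β ∈ P, α + β ∈ complementaryRoots A → α + β ∈ P
  add_isotropy_mem : ∀ α ∈ P, ∀ β ∈ isotropyRoots A, α + β ∈ roots A → α + β ∈ P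

/-! ### Isotropy decompositions and the de Siebenthal invariant -/

/-- `𝔪 = 𝔨^⊥` with respect to the Killing form. -/
def isotropySpace (𝔨 : LieSubalgebra ℝ L) : Submodule ℝ L :=
  (killingForm ℝ L).orthogonal 𝔨.toSubmodule

/-- A decomposition `𝔪 = 𝔪₁ ⊕ ⋯ ⊕ 𝔪ₛ`, orthogonal for minus the Killing form, into pairwise
inequivalent irreducible `ad(𝔨)`-modules. -/
structure IsIsotropyDecomposition {s : ℕ} (𝔪 : Fin s → LieSubmodule ℝ 𝔨 L) : Prop where
  iSup_eq : ⨆ i, (𝔪 i).toSubmodule = isotropySpace 𝔨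
  independent : iSupIndep fun i => (𝔪 i).toSubmodule
  orthogonal : ∀ i j, i ≠ j → ∀ X ∈ 𝔪 i, ∀ Y ∈ 𝔪 j, -killingForm ℝ L X Y = 0
  irreducible : ∀ i, LieModule.IsIrreducible ℝ 𝔨 (𝔪 i)
  inequivalent : ∀ i j, i ≠ j → IsEmpty (𝔪 i ≃ₗ⁅ℝ,𝔨⁆ 𝔪 j)

/-- The de Siebenthal invariant `{(i, j, k) : ([𝔪ᵢ, 𝔪ⱼ], 𝔪ₖ) ≠ 0}`, where `( , )` is minus the
Killing form. -/
def deSiebenthal {s : ℕ} (𝔪 : Fin s → LieSubmodule ℝ 𝔨 L) : Set (Fin s × Fin s × Fin s) :=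
  {p | ∃ X ∈ 𝔪 p.1, ∃ Y ∈ 𝔪 p.2.1, ∃ Z ∈ 𝔪 p.2.2, -killingForm ℝ L ⁅X, Y⁆ Z ≠ 0}

end FlagManifold

end

/-! # The de Siebenthal invariant of a generalized flag manifold

The group enters through two facts only: the Killing form `φ` of `𝔤` is negative definite
(`killingForm_neg_of_compact`), and an element of `𝔤` that commutes with the centre `𝔱` of `𝔨` lies
in `𝔨` (`mem_lieAlgebra_of_commute_centre`). Both need the differential of `Ad` to be `ad`, which is
obtained by differentiating `a x = (a x a⁻¹) a` in a chart, and the existence and uniqueness of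
one-parameter subgroups. The first fact then follows by averaging an inner product over the group,
the second because one-parameter subgroups commute as soon as their velocities do.

The rest is algebra in `𝔤^ℂ` with the inner product `⟨x, y⟩ = -φ(τ x, y)`, for which `ad X`,
`X ∈ 𝔤`, is skew-hermitian. Hence commutative subalgebras of `𝔤` are simultaneously diagonalizable
on `𝔤^ℂ` (`le_iSup_inf_weightSpace`). The zero weight space of `𝔱` is `𝔨^ℂ`, so the isotropy roots
are those vanishing on `𝔱`, and `𝔪_ξ` is the weight space of `ξ` for every `𝔱`-root `ξ`.

The key point is `killingForm_dual_nonneg`. Let `V ≠ 0` be an `ad 𝔨`-stable space of weight `ξ` with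
orthonormal basis `x₁, …, xₙ`. Then `h = ∑ [xᵢ, τ xᵢ]` commutes with `𝔨` and has weight zero, hence
lies in `𝔱^ℂ`; pairing it with `𝔱` shows that it represents `ξ` up to a factor. For a vector `y` of
weight `δ` annihilated by all `τ xᵢ` one finds `∑ ‖[xᵢ, y]‖² = ⟨y, [h, y]⟩`, whence `(δ, ξ) ≤ 0`.

* With `δ = ξ` and `y` orthogonal to `V` this shows that the weight spaces of the `𝔱`-roots are
  irreducible under `𝔨` (`eq_weightSpace_of_isAdStable`). So the complexification of an irreducible
  summand of `𝔪` is the sum of the weight spaces of some `ξ` and of `-ξ`.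
* With `δ = ξ + η` it shows that `([𝔪_ξ, 𝔪_η], 𝔪_ζ) ≠ 0` if `ξ + η + ζ = 0`
  (`exists_killingForm_lie_ne_zero`): `δ` has positive inner product with `ξ` or with `η`. The
  converse is invariance under `𝔱`, and together they describe the de Siebenthal invariant.
* By irreducibility an invariant ordering is a union of fibres of `κ`. If three `𝔱`-roots with sum
  zero were positive, then nonvanishing of `([𝔪_ξ, 𝔪_η], 𝔪_ζ)` would give three positive roots with
  sum zero, so that the sum of two positive roots would be negative.
-/

noncomputable section

section LieGroups

open scoped Topology
open VectorField MeasureTheory Set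

/-! ### The chart at the identity of a Lie group -/

namespace LieGroupChart

variable {E : Type*} [NormedAddCommGroup E] [NormedSpace ℝ E]
  (G : Type*) [TopologicalSpace G] [ChartedSpace E G] [Group G]

/-- The preferred chart of `G` at the identity. -/
abbrev chart : PartialEquiv G E := extChartAt 𝓘(ℝ, E) (1 : G)

/-- The coordinates of the identity. -/
abbrev origin : E := chart G (1 : G)

/-- The multiplication of `G` read in the chart at the identity. -/
def chartMul (p : E × E) : E := chart G ((chart G).symm p.1 * (chart G).symm p.2)

/-- The conjugation `(a, x) ↦ a x a⁻¹` of `G` read in the chart at the identity. -/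
def chartConj (p : E × E) : E :=
  chart G ((chart G).symm p.1 * (chart G).symm p.2 * ((chart G).symm p.1)⁻¹)

theorem chart_symm_origin : (chart G).symm (origin (E := E) G) = 1 :=
  extChartAt_to_inv (I := 𝓘(ℝ, E)) (1 : G)

theorem chart_target_mem : (chart G).target ∈ 𝓝 (origin (E := E) G) :=
  extChartAt_target_mem_nhds (I := 𝓘(ℝ, E)) (1 : G)

theorem chart_source_mem : (chart (E := E) G).source ∈ 𝓝 (1 : G) :=
  extChartAt_source_mem_nhds (I := 𝓘(ℝ, E)) (1 : G)

theorem origin_mem : origin (E := E) G ∈ (chart G).target := mem_of_mem_nhds (chart_target_mem G)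

/-- A map into `G` through the identity has a manifold derivative iff its chart expression has a
derivative. -/
theorem hasMFDerivAt_iff_of_eq_one {F : Type*} [NormedAddCommGroup F] [NormedSpace ℝ F]
    {f : F → G} {x : F} (hx : f x = 1) (f' : F →L[ℝ] E) :
    HasMFDerivAt 𝓘(ℝ, F) 𝓘(ℝ, E) f x f' ↔
      ContinuousAt f x ∧ HasFDerivAt (fun y => chart (E := E) G (f y)) f' x := by
  have h : HasMFDerivAt 𝓘(ℝ, F) 𝓘(ℝ, E) f x f' ↔
      ContinuousAt f x ∧ HasFDerivWithinAt (E := F) (F := E)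
        (extChartAt 𝓘(ℝ, E) (f x) ∘ f) f' (range id) x := Iff.rfl
  rw [h, hx, range_id, hasFDerivWithinAt_univ]
  rfl

theorem hasMFDerivAt_chart_one :
    HasMFDerivAt 𝓘(ℝ, E) 𝓘(ℝ, E) (chart (E := E) G) 1 (ContinuousLinearMap.id ℝ E) := by
  refine ⟨continuousAt_extChartAt (I := 𝓘(ℝ, E)) (1 : G), ?_⟩
  have h : (writtenInExtChartAt 𝓘(ℝ, E) 𝓘(ℝ, E) (1 : G) (chart (E := E) G))
      =ᶠ[𝓝 (origin G)] id := by
    filter_upwards [chart_target_mem (E := E) G] with y hy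
    simp only [writtenInExtChartAt, extChartAt_model_space_eq_id, PartialEquiv.refl_coe,
      Function.comp_apply, id]
    exact (chart G).right_inv hy
  have h' := (hasFDerivAt_id (𝕜 := ℝ) (origin (E := E) G)).congr_of_eventuallyEq h
  exact h'.hasFDerivWithinAt

variable [LieGroup 𝓘(ℝ, E) ∞ G]

theorem contMDiffAt_chart_symm {x : E} (hx : x ∈ (chart G).target) :
    ContMDiffAt 𝓘(ℝ, E) 𝓘(ℝ, E) ∞ (chart (E := E) G).symm x :=
  (contMDiffOn_extChartAt_symm (I := 𝓘(ℝ, E)) (1 : G)).contMDiffAt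
    ((isOpen_extChartAt_target (I := 𝓘(ℝ, E)) (1 : G)).mem_nhds hx)

theorem contMDiffAt_chart {g : G} (hg : g ∈ (chart (E := E) G).source) :
    ContMDiffAt 𝓘(ℝ, E) 𝓘(ℝ, E) ∞ (chart (E := E) G) g :=
  contMDiffAt_extChartAt' (by simpa using hg)

theorem contDiffAt_chartMul :
    ContDiffAt ℝ ∞ (chartMul (E := E) G) (origin G, origin G) := by
  rw [← contMDiffAt_iff_contDiffAt]
  have h1 : ContMDiffAt 𝓘(ℝ, E × E) 𝓘(ℝ, E) ∞ (fun p : E × E => (chart G).symm p.1)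
      (origin G, origin G) :=
    (contMDiffAt_chart_symm G (origin_mem G)).comp (origin G, origin G)
      contDiff_fst.contMDiff.contMDiffAt
  have h2 : ContMDiffAt 𝓘(ℝ, E × E) 𝓘(ℝ, E) ∞ (fun p : E × E => (chart G).symm p.2)
      (origin G, origin G) :=
    (contMDiffAt_chart_symm G (origin_mem G)).comp (origin G, origin G)
      contDiff_snd.contMDiff.contMDiffAt
  refine ContMDiffAt.comp (I' := 𝓘(ℝ, E)) _ ?_ (h1.mul h2)
  refine contMDiffAt_chart G ?_
  change (chart G).symm (origin G) * (chart G).symm (origin G) ∈ (chart (E := E) G).source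
  rw [chart_symm_origin, mul_one]
  exact mem_of_mem_nhds (chart_source_mem G)

theorem contDiffAt_chartConj :
    ContDiffAt ℝ ∞ (chartConj (E := E) G) (origin G, origin G) := by
  rw [← contMDiffAt_iff_contDiffAt]
  have h1 : ContMDiffAt 𝓘(ℝ, E × E) 𝓘(ℝ, E) ∞ (fun p : E × E => (chart G).symm p.1)
      (origin G, origin G) :=
    (contMDiffAt_chart_symm G (origin_mem G)).comp (origin G, origin G)
      contDiff_fst.contMDiff.contMDiffAt
  have h2 : ContMDiffAt 𝓘(ℝ, E × E) 𝓘(ℝ, E) ∞ (fun p : E × E => (chart G).symm p.2)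
      (origin G, origin G) :=
    (contMDiffAt_chart_symm G (origin_mem G)).comp (origin G, origin G)
      contDiff_snd.contMDiff.contMDiffAt
  refine ContMDiffAt.comp (I' := 𝓘(ℝ, E)) _ ?_ ((h1.mul h2).mul h1.inv)
  refine contMDiffAt_chart G ?_
  change (chart G).symm (origin G) * (chart G).symm (origin G) * ((chart G).symm (origin G))⁻¹ ∈
    (chart (E := E) G).source
  rw [chart_symm_origin, mul_one, inv_one, mul_one]
  exact mem_of_mem_nhds (chart_source_mem G)

theorem hasMFDerivAt_chart_symm :
    HasMFDerivAt 𝓘(ℝ, E) 𝓘(ℝ, E) (chart (E := E) G).symm (origin G)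
      (ContinuousLinearMap.id ℝ E) := by
  rw [hasMFDerivAt_iff_of_eq_one G (chart_symm_origin G)]
  refine ⟨(contMDiffAt_chart_symm G (origin_mem G)).continuousAt, ?_⟩
  refine (hasFDerivAt_id (𝕜 := ℝ) (origin (E := E) G)).congr_of_eventuallyEq ?_
  filter_upwards [chart_target_mem (E := E) G] with y hy
  exact (chart G).right_inv hy

end LieGroupChart

/-! ### The second derivative of multiplication and conjugation -/

namespace LieGroupChart

/-- Infinitesimal form of `a x = (a x a⁻¹) a`, for a local multiplication `m` and a local
conjugation `c` near a neutral element `e`: the derivative at `a = e` of the linear part of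
`x ↦ c (a, x)` is the antisymmetrized mixed second derivative of `m`. -/
theorem hasFDerivAt_conj_of_mul {E : Type*} [NormedAddCommGroup E] [NormedSpace ℝ E]
    {m c : E × E → E} {e : E} (hm : ContDiffAt ℝ ∞ m (e, e)) (hc : ContDiffAt ℝ ∞ c (e, e))
    (hme : ∀ᶠ x in 𝓝 e, m (x, e) = x)
    (hce : ∀ a, c (a, e) = e) (hec : ∀ᶠ x in 𝓝 e, c (e, x) = x)
    (hmc : ∀ᶠ p in 𝓝 (e, e), m p = m (c p, p.1)) (v w : E) :
    fderiv ℝ (fun a => fderiv ℝ c (a, e) (0, w)) e v =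
      fderiv ℝ (fun a => fderiv ℝ m (a, e) (0, w)) e v -
        fderiv ℝ (fun a => fderiv ℝ m (a, e) (0, v)) e w := by
  have hl : ContinuousAt (fun a : E => (a, e)) e := by fun_prop
  have hr : ContinuousAt (fun a : E => (e, a)) e := by fun_prop
  have hm1 : ∀ᶠ p in 𝓝 (e, e), DifferentiableAt ℝ m p :=
    ((hm.of_le (m := 1) (mod_cast le_top)).eventually (by simp)).mono
      fun p hp => hp.differentiableAt (by simp)
  have hc1 : ∀ᶠ p in 𝓝 (e, e), DifferentiableAt ℝ c p :=
    ((hc.of_le (m := 1) (mod_cast le_top)).eventually (by simp)).mono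
      fun p hp => hp.differentiableAt (by simp)
  have hm2 : DifferentiableAt ℝ (fderiv ℝ m) (e, e) :=
    (hm.fderiv_right (m := 1)
      (by rw [one_add_one_eq_two]; exact ENat.LEInfty.out)).differentiableAt (by simp)
  have hc2 : DifferentiableAt ℝ (fderiv ℝ c) (e, e) :=
    (hc.fderiv_right (m := 1)
      (by rw [one_add_one_eq_two]; exact ENat.LEInfty.out)).differentiableAt (by simp)
  set D := fderiv ℝ (fderiv ℝ m) (e, e) with hD
  have dl : HasFDerivAt (fun a : E => (a, e)) (ContinuousLinearMap.inl ℝ E E) e :=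
    hasFDerivAt_prodMk_left e e
  have dr : HasFDerivAt (fun a : E => (e, a)) (ContinuousLinearMap.inr ℝ E E) e :=
    hasFDerivAt_prodMk_right e e
  have hml : HasFDerivAt (fun a => fderiv ℝ m (a, e)) (D ∘L ContinuousLinearMap.inl ℝ E E) e :=
    HasFDerivAt.comp (f := fun a : E => (a, e)) e hm2.hasFDerivAt dl
  have hmr : HasFDerivAt (fun a => fderiv ℝ m (e, a)) (D ∘L ContinuousLinearMap.inr ℝ E E) e :=
    HasFDerivAt.comp (f := fun a : E => (e, a)) e hm2.hasFDerivAt dr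
  have hB : ∀ v w : E, fderiv ℝ (fun a => fderiv ℝ m (a, e) (0, w)) e v = D (v, 0) (0, w) := by
    intro v w
    have := (hml.clm_apply (hasFDerivAt_const ((0 : E), w) e)).fderiv
    rw [this]
    simp
  have hcl : DifferentiableAt ℝ (fun a => fderiv ℝ c (a, e)) e :=
    (HasFDerivAt.comp (f := fun a : E => (a, e)) e hc2.hasFDerivAt dl).differentiableAt
  have hA : DifferentiableAt ℝ (fun a => fderiv ℝ c (a, e) (0, w)) e :=
    hcl.clm_apply (differentiableAt_const _)
  -- The partial derivative of `a x = (a x a⁻¹) a` with respect to `x` at `x = e`.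
  have hkey : (fun a => fderiv ℝ m (a, e) (0, w)) =ᶠ[𝓝 e]
      fun a => fderiv ℝ m (e, a) (fderiv ℝ c (a, e) (0, w), 0) := by
    filter_upwards [hl.eventually hmc.eventually_nhds, hr.eventually hm1, hl.eventually hc1]
      with a h1 h2 h3
    have h4 : fderiv ℝ m (a, e) = fderiv ℝ (fun p : E × E => m (c p, p.1)) (a, e) :=
      Filter.EventuallyEq.fderiv_eq h1
    have h5 : HasFDerivAt (fun p : E × E => (c p, p.1))
        ((fderiv ℝ c (a, e)).prod (ContinuousLinearMap.fst ℝ E E)) (a, e) :=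
      h3.hasFDerivAt.prodMk hasFDerivAt_fst
    have h6 : HasFDerivAt m (fderiv ℝ m (e, a)) (c (a, e), (a, e).1) := by
      rw [hce]; exact h2.hasFDerivAt
    have h7 := (HasFDerivAt.comp (f := fun p : E × E => (c p, p.1)) (a, e) h6 h5).fderiv
    rw [h4]
    change fderiv ℝ (m ∘ fun p : E × E => (c p, p.1)) (a, e) (0, w) = _
    rw [h7]
    simp
  have hAe : fderiv ℝ c (e, e) (0, w) = w := by
    have h := (HasFDerivAt.comp (f := fun a : E => (e, a)) e hc1.self_of_nhds.hasFDerivAt dr)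
    have h' : HasFDerivAt (c ∘ fun a : E => (e, a)) (ContinuousLinearMap.id ℝ E) e :=
      (hasFDerivAt_id e).congr_of_eventuallyEq hec
    simpa using congrArg (fun T => T w) (h.unique h')
  have hMe : ∀ u, fderiv ℝ m (e, e) (u, 0) = u := by
    intro u
    have h := (HasFDerivAt.comp (f := fun a : E => (a, e)) e hm1.self_of_nhds.hasFDerivAt dl)
    have h' : HasFDerivAt (m ∘ fun a : E => (a, e)) (ContinuousLinearMap.id ℝ E) e :=
      (hasFDerivAt_id e).congr_of_eventuallyEq hme
    simpa using congrArg (fun T => T u) (h.unique h')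
  have hsymm : D (0, v) (w, 0) = D (w, 0) (0, v) :=
    (hm.isSymmSndFDerivAt (by
      rw [minSmoothness_of_isRCLikeNormedField]; exact ENat.LEInfty.out)).eq _ _
  -- It remains to differentiate `hkey` with respect to `a`.
  have h8 := (hmr.clm_apply (hA.hasFDerivAt.prodMk (hasFDerivAt_const (0 : E) e))).fderiv
  have h9 := congrArg (fun T => T v) (hkey.fderiv_eq.trans h8)
  simp only [hB] at h9 ⊢
  simp [hAe, hMe, hsymm] at h9
  rw [h9]
  abel

variable {E : Type*} [NormedAddCommGroup E] [NormedSpace ℝ E]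
  (G : Type*) [TopologicalSpace G] [ChartedSpace E G] [Group G]

theorem chartMul_origin_right : ∀ᶠ x in 𝓝 (origin (E := E) G), chartMul G (x, origin G) = x := by
  filter_upwards [chart_target_mem (E := E) G] with x hx
  rw [chartMul, chart_symm_origin, mul_one]
  exact (chart G).right_inv hx

theorem chartConj_origin_right (a : E) : chartConj G (a, origin G) = origin G := by
  rw [chartConj, chart_symm_origin, mul_one, mul_inv_cancel]

theorem chartConj_origin_left : ∀ᶠ x in 𝓝 (origin (E := E) G), chartConj G (origin G, x) = x := by
  filter_upwards [chart_target_mem (E := E) G] with x hx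
  rw [chartConj, chart_symm_origin, one_mul, inv_one, mul_one]
  exact (chart G).right_inv hx

variable [LieGroup 𝓘(ℝ, E) ∞ G]

theorem continuousAt_conj_chart_symm : ContinuousAt (fun p : E × E =>
    (chart G).symm p.1 * (chart G).symm p.2 * ((chart G).symm p.1)⁻¹) (origin G, origin G) := by
  have : IsTopologicalGroup G := topologicalGroup_of_lieGroup 𝓘(ℝ, E) ∞
  have h := (contMDiffAt_chart_symm G (origin_mem (E := E) G)).continuousAt
  have h1 : ContinuousAt (fun p : E × E => (chart G).symm p.1) (origin G, origin G) :=
    ContinuousAt.comp (f := Prod.fst) h continuousAt_fst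
  have h2 : ContinuousAt (fun p : E × E => (chart G).symm p.2) (origin G, origin G) :=
    ContinuousAt.comp (f := Prod.snd) h continuousAt_snd
  exact (h1.mul h2).mul h1.inv

theorem chartMul_eq_chartMul_chartConj : ∀ᶠ p in 𝓝 (origin (E := E) G, origin G),
    chartMul G p = chartMul G (chartConj G p, p.1) := by
  have h := (continuousAt_conj_chart_symm (E := E) G).eventually
    (p := fun g => g ∈ (chart (E := E) G).source) (by
      simp only [chart_symm_origin, mul_one, inv_one]
      exact chart_source_mem G)
  filter_upwards [h] with p hp
  simp only [chartMul, chartConj]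
  rw [(chart G).left_inv hp, inv_mul_cancel_right]

theorem fderiv_chartConj (v w : E) :
    fderiv ℝ (fun a => fderiv ℝ (chartConj (E := E) G) (a, origin G) (0, w)) (origin G) v =
      fderiv ℝ (fun a => fderiv ℝ (chartMul (E := E) G) (a, origin G) (0, w)) (origin G) v -
        fderiv ℝ (fun a => fderiv ℝ (chartMul (E := E) G) (a, origin G) (0, v)) (origin G) w :=
  hasFDerivAt_conj_of_mul (contDiffAt_chartMul G) (contDiffAt_chartConj G)
    (chartMul_origin_right G) (chartConj_origin_right G) (chartConj_origin_left G)
    (chartMul_eq_chartMul_chartConj G) v w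

end LieGroupChart

/-! ### The adjoint representation -/

namespace LieGroupChart

variable {E : Type*} [NormedAddCommGroup E] [NormedSpace ℝ E]
  {G : Type*} [TopologicalSpace G] [ChartedSpace E G]

/-- Transport of a derivative along an equality of base points; all tangent spaces are `E`. -/
theorem hasMFDerivAt_of_eq {f : G → G} {x y : G} (h : x = y) {f' : E →L[ℝ] E}
    (hf : HasMFDerivAt 𝓘(ℝ, E) 𝓘(ℝ, E) f x f') : HasMFDerivAt 𝓘(ℝ, E) 𝓘(ℝ, E) f y f' := by
  subst h
  exact hf

variable [Group G]

variable (G) in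
/-- The Lie bracket of the tangent space at the identity, as an operation on the model space. -/
def tangentBracket (v w : E) : E :=
  Bracket.bracket (L := GroupLieAlgebra 𝓘(ℝ, E) G) (M := GroupLieAlgebra 𝓘(ℝ, E) G) v w

theorem hasMFDerivAt_comp_chart_symm [LieGroup 𝓘(ℝ, E) ∞ G] {f : G → G} {f' : E →L[ℝ] E}
    (hf : HasMFDerivAt 𝓘(ℝ, E) 𝓘(ℝ, E) f 1 f') :
    HasMFDerivAt 𝓘(ℝ, E) 𝓘(ℝ, E) (fun x => f ((chart G).symm x)) (origin (E := E) G) f' :=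
  HasMFDerivAt.comp (origin (E := E) G)
    (hasMFDerivAt_of_eq (chart_symm_origin (E := E) G).symm hf) (hasMFDerivAt_chart_symm G)

theorem differentiableAt_chartMul [LieGroup 𝓘(ℝ, E) ∞ G] :
    ∀ᶠ x in 𝓝 (origin (E := E) G), DifferentiableAt ℝ (chartMul (E := E) G) (x, origin G) := by
  have hl : ContinuousAt (fun a : E => (a, origin (E := E) G)) (origin G) := by fun_prop
  exact hl.eventually ((((contDiffAt_chartMul (E := E) G).of_le (m := 1)
    (mod_cast le_top)).eventually (by simp)).mono fun p hp => hp.differentiableAt (by simp))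

theorem differentiableAt_chartConj [LieGroup 𝓘(ℝ, E) ∞ G] :
    ∀ᶠ x in 𝓝 (origin (E := E) G), DifferentiableAt ℝ (chartConj (E := E) G) (x, origin G) := by
  have hl : ContinuousAt (fun a : E => (a, origin (E := E) G)) (origin G) := by fun_prop
  exact hl.eventually ((((contDiffAt_chartConj (E := E) G).of_le (m := 1)
    (mod_cast le_top)).eventually (by simp)).mono fun p hp => hp.differentiableAt (by simp))

section Left

variable [LieGroup 𝓘(ℝ, E) ∞ G]

theorem hasMFDerivAt_mul_left (g h : G) :
    HasMFDerivAt 𝓘(ℝ, E) 𝓘(ℝ, E) (fun x : G => g * x) h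
      (mfderiv 𝓘(ℝ, E) 𝓘(ℝ, E) (fun x : G => g * x) h) :=
  ((contMDiff_mul_left (I := 𝓘(ℝ, E)) (n := ∞) (a := g)).mdifferentiableAt (by simp)).hasMFDerivAt

/-- The derivative of the chart maps the left invariant vector field to its chart expression. -/
theorem mfderiv_chart_mulInvariantVectorField (v : E) : ∀ᶠ x in 𝓝 (origin (E := E) G),
    (mfderiv 𝓘(ℝ, E) 𝓘(ℝ, E) (chart (E := E) G) ((chart G).symm x))
      (mulInvariantVectorField (I := 𝓘(ℝ, E)) (G := G) v ((chart G).symm x)) =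
        fderiv ℝ (chartMul (E := E) G) (x, origin G) (0, v) := by
  filter_upwards [chart_target_mem (E := E) G, differentiableAt_chartMul (E := E) (G := G)]
    with x hx hd
  set g : G := (chart G).symm x with hg
  have hgs : g ∈ (chart (E := E) G).source := (chart G).map_target hx
  let A : E →L[ℝ] E := mfderiv 𝓘(ℝ, E) 𝓘(ℝ, E) (fun x : G => g * x) 1
  let B : E →L[ℝ] E := mfderiv 𝓘(ℝ, E) 𝓘(ℝ, E) (chart (E := E) G) g
  have h1 : HasMFDerivAt 𝓘(ℝ, E) 𝓘(ℝ, E) (fun y => g * (chart G).symm y) (origin (E := E) G) A :=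
    hasMFDerivAt_comp_chart_symm (hasMFDerivAt_mul_left g 1)
  have h2 : HasMFDerivAt 𝓘(ℝ, E) 𝓘(ℝ, E) (chart (E := E) G)
      (g * (chart G).symm (origin (E := E) G)) B := by
    have h3 : HasMFDerivAt 𝓘(ℝ, E) 𝓘(ℝ, E) (chart (E := E) G) g B :=
      ((contMDiffAt_chart G hgs).mdifferentiableAt (by simp)).hasMFDerivAt
    have h4 : g * (chart G).symm (origin (E := E) G) = g := by rw [chart_symm_origin, mul_one]
    rw [h4]
    exact h3
  have h5 : HasFDerivAt (fun y => chartMul (E := E) G (x, y)) (B ∘L A) (origin G) :=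
    (HasMFDerivAt.comp (origin (E := E) G) h2 h1).hasFDerivAt
  have h6 : HasFDerivAt (fun y => chartMul (E := E) G (x, y)) _ (origin G) :=
    HasFDerivAt.comp (f := fun y : E => (x, y)) (origin G) hd.hasFDerivAt
      (hasFDerivAt_prodMk_right x (origin G))
  have h7 := congrArg (fun T : E →L[ℝ] E => T v) (h5.unique h6)
  exact h7.trans (by simp)

theorem mpullbackWithin_mulInvariantVectorField (v : E) : ∀ᶠ x in 𝓝 (origin (E := E) G),
    mpullbackWithin 𝓘(ℝ, E) 𝓘(ℝ, E) (chart (E := E) G).symm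
      (mulInvariantVectorField (I := 𝓘(ℝ, E)) (G := G) v) (range 𝓘(ℝ, E)) x =
        fderiv ℝ (chartMul (E := E) G) (x, origin G) (0, v) := by
  have : IsManifold 𝓘(ℝ, E) 1 G := IsManifold.of_le (n := ∞) (by simp)
  filter_upwards [chart_target_mem (E := E) G, mfderiv_chart_mulInvariantVectorField (G := G) v]
    with x hx h
  rw [← h, mpullbackWithin_apply]
  congr 1
  exact ContinuousLinearMap.inverse_eq
    (mfderivWithin_extChartAt_symm_comp_mfderiv_extChartAt hx)
    (mfderiv_extChartAt_comp_mfderivWithin_extChartAt_symm hx)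

/-- In the chart at the identity, the Lie bracket is the antisymmetrized mixed second derivative of
the multiplication. -/
theorem tangentBracket_eq_fderiv_chartMul (v w : E) :
    tangentBracket G v w =
      fderiv ℝ (fun a => fderiv ℝ (chartMul (E := E) G) (a, origin G) (0, w)) (origin G) v -
        fderiv ℝ (fun a => fderiv ℝ (chartMul (E := E) G) (a, origin G) (0, v)) (origin G) w := by
  let V : E → E := mpullbackWithin 𝓘(ℝ, E) 𝓘(ℝ, E) (chart (E := E) G).symm
    (mulInvariantVectorField (I := 𝓘(ℝ, E)) (G := G) v) (range 𝓘(ℝ, E))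
  let W : E → E := mpullbackWithin 𝓘(ℝ, E) 𝓘(ℝ, E) (chart (E := E) G).symm
    (mulInvariantVectorField (I := 𝓘(ℝ, E)) (G := G) w) (range 𝓘(ℝ, E))
  let D : E →L[ℝ] E := mfderiv 𝓘(ℝ, E) 𝓘(ℝ, E) (chart (E := E) G) 1
  have h1 : D = ContinuousLinearMap.id ℝ E := (hasMFDerivAt_chart_one G).mfderiv
  have h2 : tangentBracket G v w = D.inverse (lieBracketWithin ℝ V W
        ((chart (E := E) G).symm ⁻¹' univ ∩ range 𝓘(ℝ, E)) (origin G)) := rfl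
  have h3 : (chart (E := E) G).symm ⁻¹' univ ∩ range 𝓘(ℝ, E) = univ := by simp
  rw [h2, h1, ContinuousLinearMap.inverse_id, h3, lieBracketWithin_univ,
    ContinuousLinearMap.id_apply, Filter.EventuallyEq.lieBracket_vectorField_eq
    (mpullbackWithin_mulInvariantVectorField (G := G) v)
    (mpullbackWithin_mulInvariantVectorField (G := G) w), lieBracket]
  have h5 : ∀ u : E, fderiv ℝ (chartMul (E := E) G) (origin G, origin G) (0, u) = u := by
    intro u
    have h6 : HasFDerivAt (fun y => chartMul (E := E) G (origin G, y)) _ (origin G) :=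
      HasFDerivAt.comp (f := fun y : E => (origin G, y)) (origin G)
        (differentiableAt_chartMul (E := E) (G := G)).self_of_nhds.hasFDerivAt
        (hasFDerivAt_prodMk_right (origin G) (origin G))
    have h7 : (fun y => chartMul (E := E) G (origin G, y)) =ᶠ[𝓝 (origin G)] id := by
      filter_upwards [chart_target_mem (E := E) G] with x hx
      simp only [chartMul, chart_symm_origin, one_mul]
      exact (chart G).right_inv hx
    simpa using congrArg (fun T => T u) (h6.unique
      ((hasFDerivAt_id (origin (E := E) G)).congr_of_eventuallyEq h7))
  rw [h5, h5]

end Left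

variable (E) in
/-- The adjoint representation of a Lie group on its tangent space at the identity. -/
def Ad (g : G) : E →L[ℝ] E := mfderiv 𝓘(ℝ, E) 𝓘(ℝ, E) (fun x : G => g * x * g⁻¹) (1 : G)

theorem Ad_one : Ad E (1 : G) = ContinuousLinearMap.id ℝ E := by
  have h3 : (fun x : G => (1 : G) * x * (1 : G)⁻¹) = id := by
    funext x
    simp
  have : mfderiv 𝓘(ℝ, E) 𝓘(ℝ, E) (fun x : G => (1 : G) * x * (1 : G)⁻¹) (1 : G) = _ :=
    (h3 ▸ hasMFDerivAt_id (I := 𝓘(ℝ, E)) (1 : G)).mfderiv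
  exact this

/-- `γ` is a homomorphism `ℝ → G` with initial velocity `X`. -/
structure IsOneParam (γ : ℝ → G) (X : E) : Prop where
  map_add : ∀ a b, γ (a + b) = γ a * γ b
  hasMFDerivAt : HasMFDerivAt 𝓘(ℝ, ℝ) 𝓘(ℝ, E) γ 0 ((1 : ℝ →L[ℝ] ℝ).smulRight X)

theorem IsOneParam.map_zero {γ : ℝ → G} {X : E} (h : IsOneParam γ X) : γ 0 = 1 := by
  have := h.map_add 0 0
  simpa using this

theorem IsOneParam.hasDerivAt_chart {γ : ℝ → G} {X : E} (h : IsOneParam γ X) :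
    HasDerivAt (fun t => chart (E := E) G (γ t)) X 0 := by
  have h1 := ((hasMFDerivAt_iff_of_eq_one G h.map_zero _).1 h.hasMFDerivAt).2.hasDerivAt
  have h2 : ((1 : ℝ →L[ℝ] ℝ).smulRight X) 1 = X := by simp
  rw [← h2]
  exact h1

variable [LieGroup 𝓘(ℝ, E) ∞ G]

theorem hasMFDerivAt_conj (g : G) :
    HasMFDerivAt 𝓘(ℝ, E) 𝓘(ℝ, E) (fun x : G => g * x * g⁻¹) 1 (Ad E g) := by
  have h1 : ContMDiff 𝓘(ℝ, E) 𝓘(ℝ, E) ∞ (fun x : G => g * x * g⁻¹) :=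
    contMDiff_mul_right.comp (contMDiff_mul_left (a := g))
  exact (h1.mdifferentiableAt (by simp)).hasMFDerivAt

theorem Ad_mul (g h : G) : Ad E (g * h) = Ad E g ∘L Ad E h := by
  have h1 : HasMFDerivAt 𝓘(ℝ, E) 𝓘(ℝ, E) (fun x : G => g * x * g⁻¹) (h * 1 * h⁻¹) (Ad E g) :=
    hasMFDerivAt_of_eq (by simp) (hasMFDerivAt_conj g)
  have h2 := HasMFDerivAt.comp (1 : G) h1 (hasMFDerivAt_conj (E := E) h)
  have h3 : ((fun x : G => g * x * g⁻¹) ∘ fun x : G => h * x * h⁻¹) =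
      fun x : G => (g * h) * x * (g * h)⁻¹ := by
    funext x
    simp [mul_assoc]
  rw [h3] at h2
  exact h2.mfderiv

theorem hasFDerivAt_chartConj (a : E) :
    HasFDerivAt (fun x => chartConj (E := E) G (a, x)) (Ad E ((chart G).symm a)) (origin G) := by
  have h := hasMFDerivAt_comp_chart_symm (hasMFDerivAt_conj (E := E) ((chart G).symm a))
  exact ((hasMFDerivAt_iff_of_eq_one G (by simp only [chart_symm_origin]; simp) _).1 h).2

theorem Ad_chart_symm : ∀ᶠ a in 𝓝 (origin (E := E) G), ∀ w,
    Ad E ((chart G).symm a) w = fderiv ℝ (chartConj (E := E) G) (a, origin G) (0, w) := by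
  filter_upwards [differentiableAt_chartConj (E := E) (G := G)] with a ha w
  have h6 : HasFDerivAt (fun y => chartConj (E := E) G (a, y)) _ (origin G) :=
    HasFDerivAt.comp (f := fun y : E => (a, y)) (origin G) ha.hasFDerivAt
      (hasFDerivAt_prodMk_right a (origin G))
  simpa using congrArg (fun T => T w) ((hasFDerivAt_chartConj a).unique h6)

/-- The differential of `Ad` at the identity is `ad`. -/
theorem hasFDerivAt_Ad_chart_symm (w : E) :
    ∃ D : E →L[ℝ] E, HasFDerivAt (fun a => Ad E ((chart G).symm a) w) D (origin (E := E) G) ∧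
      ∀ v, D v = tangentBracket G v w := by
  have hc2 : DifferentiableAt ℝ (fderiv ℝ (chartConj (E := E) G)) (origin G, origin G) :=
    ((contDiffAt_chartConj G).fderiv_right (m := 1)
      (by rw [one_add_one_eq_two]; exact ENat.LEInfty.out)).differentiableAt (by simp)
  have hcl : DifferentiableAt ℝ (fun a => fderiv ℝ (chartConj (E := E) G) (a, origin G))
      (origin G) :=
    (HasFDerivAt.comp (f := fun a : E => (a, origin G)) (origin G) hc2.hasFDerivAt
      (hasFDerivAt_prodMk_left _ _)).differentiableAt
  have hA : DifferentiableAt ℝ (fun a => fderiv ℝ (chartConj (E := E) G) (a, origin G) (0, w))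
      (origin G) := hcl.clm_apply (differentiableAt_const _)
  refine ⟨_, hA.hasFDerivAt.congr_of_eventuallyEq ?_, fun v => ?_⟩
  · filter_upwards [Ad_chart_symm (E := E) (G := G)] with a ha using ha w
  · exact (fderiv_chartConj G v w).trans (tangentBracket_eq_fderiv_chartMul v w).symm

theorem IsOneParam.hasDerivAt_Ad_zero {γ : ℝ → G} {X : E}
    (h : IsOneParam (E := E) γ X) (w : E) :
    HasDerivAt (fun t => Ad E (γ t) w) (tangentBracket G X w) 0 := by
  obtain ⟨D, hD, hD'⟩ := hasFDerivAt_Ad_chart_symm (G := G) w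
  have h0 : chart (E := E) G (γ 0) = origin G := by rw [h.map_zero]
  have h1 := HasFDerivAt.comp_hasDerivAt_of_eq (0 : ℝ) hD h.hasDerivAt_chart h0.symm
  have h2 : HasDerivAt (fun t => Ad E (γ t) w) (D X) 0 := by
    refine h1.congr_of_eventuallyEq ?_
    have hs : (chart (E := E) G).source ∈ 𝓝 (γ 0) := by
      rw [h.map_zero]; exact chart_source_mem G
    filter_upwards [h.hasMFDerivAt.continuousAt hs] with t ht
    simp only [Function.comp_apply]
    rw [(chart G).left_inv ht]
  rw [hD'] at h2
  exact h2

theorem IsOneParam.hasDerivAt_Ad {γ : ℝ → G} {X : E}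
    (h : IsOneParam (E := E) γ X) (w : E) (t : ℝ) :
    HasDerivAt (fun t => Ad E (γ t) w)
      (Ad E (γ t) (tangentBracket G X w)) t := by
  have h1 := h.hasDerivAt_Ad_zero w
  have h2 : HasDerivAt (fun s => Ad E (γ (s - t)) w)
      (tangentBracket G X w) t :=
    HasDerivAt.comp_sub_const t t (by rw [sub_self]; exact h1)
  have h3 := (Ad E (γ t)).hasFDerivAt.comp_hasDerivAt t h2
  refine h3.congr_of_eventuallyEq (Filter.Eventually.of_forall fun s => ?_)
  have h4 : γ s = γ t * γ (s - t) := by rw [← h.map_add]; congr 1; ring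
  simp only [Function.comp_apply]
  rw [h4, Ad_mul]
  rfl

variable (E) in
theorem continuous_Ad (w : E) : Continuous fun g : G => Ad E g w := by
  have : IsTopologicalGroup G := topologicalGroup_of_lieGroup 𝓘(ℝ, E) ∞
  obtain ⟨D, hD, -⟩ := hasFDerivAt_Ad_chart_symm (E := E) (G := G) w
  have h1 : ContinuousAt (fun g : G => Ad E g w) 1 := by
    have h2 : ContinuousAt (fun g : G => Ad E ((chart G).symm (chart (E := E) G g)) w) 1 :=
      ContinuousAt.comp (f := chart (E := E) G) hD.continuousAt
        (continuousAt_extChartAt (I := 𝓘(ℝ, E)) (1 : G))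
    refine h2.congr ?_
    filter_upwards [chart_source_mem (E := E) G] with g hg
    rw [(chart G).left_inv hg]
  refine continuous_iff_continuousAt.2 fun g₀ => ?_
  have h3 : (fun g : G => Ad E g w) = fun g => Ad E g₀ (Ad E (g₀⁻¹ * g) w) := by
    funext g
    rw [← ContinuousLinearMap.comp_apply, ← Ad_mul, mul_inv_cancel_left]
  rw [h3]
  refine (Ad E g₀).continuous.continuousAt.comp ?_
  refine ContinuousAt.comp (g := fun g : G => Ad E g w) (f := fun g => g₀⁻¹ * g) ?_ (by fun_prop)
  rw [inv_mul_cancel]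
  exact h1

end LieGroupChart

/-! ### One-parameter subgroups -/

namespace LieGroupChart

variable {E : Type*} [NormedAddCommGroup E] [NormedSpace ℝ E]
  {G : Type*} [TopologicalSpace G] [ChartedSpace E G] [Group G] [LieGroup 𝓘(ℝ, E) ∞ G]

omit [Group G] [LieGroup 𝓘(ℝ, E) ∞ G] in
theorem hasMFDerivWithinAt_congr {f : ℝ → G} {s : Set ℝ} {t : ℝ} {A B : ℝ →L[ℝ] E}
    (h : HasMFDerivWithinAt 𝓘(ℝ, ℝ) 𝓘(ℝ, E) f s t A) (hAB : A = B) :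
    HasMFDerivWithinAt 𝓘(ℝ, ℝ) 𝓘(ℝ, E) f s t B := hAB ▸ h

omit [Group G] [LieGroup 𝓘(ℝ, E) ∞ G] in
theorem hasMFDerivAt_congr {f : ℝ → G} {t : ℝ} {A B : ℝ →L[ℝ] E}
    (h : HasMFDerivAt 𝓘(ℝ, ℝ) 𝓘(ℝ, E) f t A) (hAB : A = B) :
    HasMFDerivAt 𝓘(ℝ, ℝ) 𝓘(ℝ, E) f t B := hAB ▸ h

variable (G) in
/-- The left invariant vector field with value `X` at the identity. -/
def leftField (X : E) (g : G) : TangentSpace 𝓘(ℝ, E) g :=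
  mulInvariantVectorField (I := 𝓘(ℝ, E)) (G := G) X g

theorem contMDiff_leftField (X : E) : ContMDiff 𝓘(ℝ, E) 𝓘(ℝ, E).tangent 1
    (fun g : G => (⟨g, leftField G X g⟩ : TangentBundle 𝓘(ℝ, E) G)) :=
  (contMDiff_mulInvariantVectorField (I := 𝓘(ℝ, E)) (G := G) X).of_le
    (one_le_two.trans le_minSmoothness)

/-- The derivative of a left translation, as an endomorphism of the model space. -/
def leftDeriv (g h : G) : E →L[ℝ] E := mfderiv 𝓘(ℝ, E) 𝓘(ℝ, E) (fun x : G => g * x) h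

/-- The value of the left invariant vector field `leftField G X`, read in the model space. -/
def leftVal (X : E) (g : G) : E := (leftDeriv g 1 : E →L[ℝ] E) X

theorem leftDeriv_leftVal (g h : G) (X : E) :
    leftDeriv g h (leftVal X h) = leftVal X (g * h) := by
  have h1 : HasMFDerivAt 𝓘(ℝ, E) 𝓘(ℝ, E) (fun x : G => g * x) (h * 1)
      (leftDeriv g h : E →L[ℝ] E) :=
    hasMFDerivAt_of_eq (mul_one h).symm (hasMFDerivAt_mul_left g h)
  have h2 := HasMFDerivAt.comp (1 : G) h1 (hasMFDerivAt_mul_left (E := E) h 1)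
  have h3 : ((fun x : G => g * x) ∘ fun x : G => h * x) = fun x : G => (g * h) * x := by
    funext x
    simp [mul_assoc]
  rw [h3] at h2
  have h4 : (leftDeriv (g * h) 1 : E →L[ℝ] E) = leftDeriv g h ∘L leftDeriv h 1 := h2.mfderiv
  exact (congrArg (fun T : E →L[ℝ] E => T X) h4).symm

omit [LieGroup 𝓘(ℝ, E) ∞ G] in
theorem leftVal_one (X : E) : leftVal X (1 : G) = X := by
  have h3 : (fun x : G => (1 : G) * x) = id := by
    funext x
    simp
  have h4 : (leftDeriv (1 : G) 1 : E →L[ℝ] E) = ContinuousLinearMap.id ℝ E :=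
    (h3 ▸ hasMFDerivAt_id (I := 𝓘(ℝ, E)) (1 : G)).mfderiv
  exact congrArg (fun T : E →L[ℝ] E => T X) h4

/-- Left translates of integral curves of left invariant fields are integral curves. -/
theorem isMIntegralCurveOn_mul_left {γ : ℝ → G} {X : E} {s : Set ℝ}
    (h : IsMIntegralCurveOn (I := 𝓘(ℝ, E)) γ (leftField G X) s) (g : G) :
    IsMIntegralCurveOn (I := 𝓘(ℝ, E)) (fun t => g * γ t) (leftField G X) s := by
  intro t ht
  have h1 := HasMFDerivAt.comp_hasMFDerivWithinAt t
    (hasMFDerivAt_mul_left (E := E) g (γ t)) (h t ht)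
  have h2 : (leftDeriv g (γ t) : E →L[ℝ] E) ∘L
      ((1 : ℝ →L[ℝ] ℝ).smulRight (leftVal X (γ t))) =
      (1 : ℝ →L[ℝ] ℝ).smulRight (leftVal X (g * γ t)) := by
    ext
    simp [← leftDeriv_leftVal]
  exact hasMFDerivWithinAt_congr h1 h2

theorem isMIntegralCurve_mul_left {γ : ℝ → G} {X : E}
    (h : IsMIntegralCurve (I := 𝓘(ℝ, E)) γ (leftField G X)) (g : G) :
    IsMIntegralCurve (I := 𝓘(ℝ, E)) (fun t => g * γ t) (leftField G X) := by
  exact isMIntegralCurve_iff_isMIntegralCurveOn.2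
    (isMIntegralCurveOn_mul_left (isMIntegralCurve_iff_isMIntegralCurveOn.1 h) g)

theorem IsOneParam.isMIntegralCurve {γ : ℝ → G} {X : E} (h : IsOneParam γ X) :
    IsMIntegralCurve (I := 𝓘(ℝ, E)) γ (leftField G X) := by
  intro t
  have h0 : HasMFDerivAt 𝓘(ℝ, ℝ) 𝓘(ℝ, E) γ (t - t) ((1 : ℝ →L[ℝ] ℝ).smulRight X) := by
    rw [sub_self]; exact h.hasMFDerivAt
  have h1 : HasMFDerivAt 𝓘(ℝ, ℝ) 𝓘(ℝ, ℝ) (fun s : ℝ => s - t) t (ContinuousLinearMap.id ℝ ℝ) :=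
    ((hasFDerivAt_id (𝕜 := ℝ) t).sub_const t).hasMFDerivAt
  have h2 := HasMFDerivAt.comp (f := fun s : ℝ => s - t) t h0 h1
  have h3 : HasMFDerivAt 𝓘(ℝ, E) 𝓘(ℝ, E) (fun x : G => γ t * x) (γ (t - t))
      (leftDeriv (γ t) 1 : E →L[ℝ] E) :=
    hasMFDerivAt_of_eq (by rw [sub_self, h.map_zero]) (hasMFDerivAt_mul_left (γ t) 1)
  have h4 := HasMFDerivAt.comp t h3 h2
  have h5 : ((fun x : G => γ t * x) ∘ γ ∘ fun s : ℝ => s - t) = γ := by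
    funext s
    simp only [Function.comp_apply]
    rw [← h.map_add]
    congr 1
    ring
  rw [h5] at h4
  have h6 : (leftDeriv (γ t) 1 : E →L[ℝ] E) ∘L
      ((1 : ℝ →L[ℝ] ℝ).smulRight X ∘L ContinuousLinearMap.id ℝ ℝ) =
      (1 : ℝ →L[ℝ] ℝ).smulRight (leftVal X (γ t)) := by
    ext
    simp only [ContinuousLinearMap.comp_apply, ContinuousLinearMap.id_apply,
      ContinuousLinearMap.smulRight_apply, one_apply_eq_self, one_smul]
    rfl
  exact hasMFDerivAt_congr h4 h6

/-- A one-parameter subgroup is determined by its initial velocity. -/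
theorem IsOneParam.unique [T2Space G] [CompleteSpace E] {γ δ : ℝ → G} {X : E}
    (h : IsOneParam γ X) (h' : IsOneParam δ X) :
    γ = δ := by
  have : IsManifold 𝓘(ℝ, E) 1 G := IsManifold.of_le (n := ∞) (by simp)
  exact isMIntegralCurve_Ioo_eq_of_contMDiff_boundaryless (t₀ := 0)
    (contMDiff_leftField X) h.isMIntegralCurve h'.isMIntegralCurve (by rw [h.map_zero, h'.map_zero])

/-- Every tangent vector at the identity is the velocity of a one-parameter subgroup: an integral
curve of the left invariant field through the identity exists for a short time, left translations
give all other points curves of the same length, so it extends to all times. -/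
theorem exists_isOneParam [T2Space G] [CompleteSpace E] (X : E) :
    ∃ γ : ℝ → G, IsOneParam γ X := by
  have : IsManifold 𝓘(ℝ, E) 1 G := IsManifold.of_le (n := ∞) (by simp)
  obtain ⟨γ₀, h0, h1⟩ := exists_isMIntegralCurveAt_of_contMDiffAt_boundaryless
    (I := 𝓘(ℝ, E)) (t₀ := 0) (x₀ := (1 : G)) (v := leftField G X)
    (contMDiff_leftField X).contMDiffAt
  obtain ⟨ε, hε, h2⟩ := isMIntegralCurveAt_iff'.1 h1
  rw [Real.ball_eq_Ioo, zero_sub, zero_add] at h2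
  obtain ⟨γ, hγ0, hγ⟩ := exists_isMIntegralCurve_of_isMIntegralCurveOn
    (I := 𝓘(ℝ, E)) (v := leftField G X) (contMDiff_leftField X) hε
    (fun x => ⟨fun t => x * γ₀ t, by simp [h0], isMIntegralCurveOn_mul_left h2 x⟩) (1 : G)
  refine ⟨γ, fun a b => ?_, ?_⟩
  · have h3 : IsMIntegralCurve (I := 𝓘(ℝ, E)) (γ ∘ (· + a)) (leftField G X) := hγ.comp_add a
    have h4 := isMIntegralCurve_Ioo_eq_of_contMDiff_boundaryless (t₀ := 0)
      (contMDiff_leftField X) h3 (isMIntegralCurve_mul_left hγ (γ a)) (by simp [hγ0])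
    have h5 := congrFun h4 b
    simp only [Function.comp_apply] at h5
    rw [← h5, add_comm]
  · have h3 := hγ 0
    have h4 : leftVal X (γ 0) = X := by rw [hγ0, leftVal_one]
    exact hasMFDerivAt_congr h3 (congrArg _ h4)

theorem IsOneParam.continuous {γ : ℝ → G} {X : E} (h : IsOneParam γ X) : Continuous γ :=
  continuous_iff_continuousAt.2 fun t => (h.isMIntegralCurve t).continuousAt

theorem IsOneParam.eventually_hasDerivAt_chart {γ : ℝ → G} {X : E} (h : IsOneParam γ X) :
    ∀ᶠ t in 𝓝 (0 : ℝ), HasDerivAt (fun t => chart (E := E) G (γ t))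
      (fderiv ℝ (chartMul (E := E) G) (chart (E := E) G (γ t), origin G) (0, X)) t := by
  have hc : ContinuousAt (fun t => chart (E := E) G (γ t)) 0 := h.hasDerivAt_chart.continuousAt
  have h0 : chart (E := E) G (γ 0) = origin G := by rw [h.map_zero]
  have hs : ∀ᶠ t in 𝓝 (0 : ℝ), γ t ∈ (chart (E := E) G).source :=
    h.continuous.continuousAt (by rw [h.map_zero]; exact chart_source_mem G)
  have hm := mfderiv_chart_mulInvariantVectorField (E := E) (G := G) X
  have hm' := hc.tendsto.eventually (p := fun x => (mfderiv 𝓘(ℝ, E) 𝓘(ℝ, E) (chart (E := E) G)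
      ((chart G).symm x)) (mulInvariantVectorField (I := 𝓘(ℝ, E)) (G := G) X ((chart G).symm x)) =
        fderiv ℝ (chartMul (E := E) G) (x, origin G) (0, X)) (by rw [h0]; exact hm)
  filter_upwards [hs, hm'] with t ht1 ht2
  rw [← ht2]
  let B : E →L[ℝ] E := mfderiv 𝓘(ℝ, E) 𝓘(ℝ, E) (chart (E := E) G) (γ t)
  have h3 : HasMFDerivAt 𝓘(ℝ, E) 𝓘(ℝ, E) (chart (E := E) G) (γ t) B :=
      ((contMDiffAt_chart G ht1).mdifferentiableAt (by simp)).hasMFDerivAt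
  have h4 : HasFDerivAt (fun t => chart (E := E) G (γ t))
      (B ∘L ((1 : ℝ →L[ℝ] ℝ).smulRight (leftVal X (γ t)))) t :=
    (HasMFDerivAt.comp t h3 (h.isMIntegralCurve t)).hasFDerivAt
  have h5 := h4.hasDerivAt
  rw [(chart G).left_inv ht1]
  have h6 : (B ∘L ((1 : ℝ →L[ℝ] ℝ).smulRight (leftVal X (γ t)))) 1 =
      B (leftVal X (γ t)) := by
    simp
  rw [h6] at h5
  exact h5

/-- One-parameter subgroups are smooth near `0`: in the chart they solve an ordinary differential
equation with smooth right-hand side, so that each order of differentiability gives the next. -/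
theorem IsOneParam.contDiffAt_chart {γ : ℝ → G} {X : E} (h : IsOneParam γ X) :
    ContDiffAt ℝ ∞ (fun t => chart (E := E) G (γ t)) 0 := by
  have h0 : chart (E := E) G (γ 0) = origin G := by rw [h.map_zero]
  have hV : ContDiffAt ℝ ∞ (fun x => fderiv ℝ (chartMul (E := E) G) (x, origin G) (0, X))
      (origin G) := by
    have h1 : ContDiffAt ℝ ∞ (fderiv ℝ (chartMul (E := E) G)) (origin G, origin G) :=
      (contDiffAt_chartMul G).fderiv_right (m := ∞) (by simp)
    have h2 : ContDiffAt ℝ ∞ (fun x => fderiv ℝ (chartMul (E := E) G) (x, origin G)) (origin G) :=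
      ContDiffAt.comp (f := fun x : E => (x, origin (E := E) G)) (origin G) h1 (by fun_prop)
    exact h2.clm_apply contDiffAt_const
  have key : ∀ n : ℕ, ContDiffAt ℝ n (fun t => chart (E := E) G (γ t)) 0 := by
    intro n
    induction n with
    | zero =>
      rw [Nat.cast_zero, contDiffAt_zero]
      have hs : ∀ᶠ t in 𝓝 (0 : ℝ), γ t ∈ (chart (E := E) G).source :=
        h.continuous.continuousAt (by rw [h.map_zero]; exact chart_source_mem G)
      refine ⟨_, hs, fun t ht => ?_⟩
      exact (ContinuousAt.comp (f := γ) (contMDiffAt_chart G ht).continuousAt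
        h.continuous.continuousAt).continuousWithinAt
    | succ n ih =>
      rw [Nat.cast_succ, contDiffAt_succ_iff_hasFDerivAt]
      refine ⟨fun t => (1 : ℝ →L[ℝ] ℝ).smulRight
        (fderiv ℝ (chartMul (E := E) G) (chart (E := E) G (γ t), origin G) (0, X)),
        ⟨_, h.eventually_hasDerivAt_chart, fun t ht => ht.hasFDerivAt⟩, ?_⟩
      have h1 : ContDiffAt ℝ n (fun t =>
          fderiv ℝ (chartMul (E := E) G) (chart (E := E) G (γ t), origin G) (0, X)) 0 := by
        refine ContDiffAt.comp (g := fun x => fderiv ℝ (chartMul (E := E) G) (x, origin G) (0, X))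
          (f := fun t => chart (E := E) G (γ t)) (0 : ℝ) ?_ ih
        rw [h0]
        exact hV.of_le (mod_cast le_top)
      exact (ContinuousLinearMap.smulRightL ℝ ℝ E (1 : ℝ →L[ℝ] ℝ)).contDiff.contDiffAt.comp (0 : ℝ)
        h1
  exact contDiffAt_infty.2 key

theorem IsOneParam.contMDiff {γ : ℝ → G} {X : E} (h : IsOneParam γ X) :
    ContMDiff 𝓘(ℝ, ℝ) 𝓘(ℝ, E) ∞ γ := by
  have h0 : ContMDiffAt 𝓘(ℝ, ℝ) 𝓘(ℝ, E) ∞ γ 0 := by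
    have h1 : ContMDiffAt 𝓘(ℝ, E) 𝓘(ℝ, E) ∞ (chart (E := E) G).symm (chart (E := E) G (γ 0)) := by
      rw [h.map_zero]
      exact contMDiffAt_chart_symm G (origin_mem G)
    have h2 := ContMDiffAt.comp (f := fun t => chart (E := E) G (γ t)) (0 : ℝ) h1
      h.contDiffAt_chart.contMDiffAt
    refine h2.congr_of_eventuallyEq ?_
    have hs : ∀ᶠ t in 𝓝 (0 : ℝ), γ t ∈ (chart (E := E) G).source :=
      h.continuous.continuousAt (by rw [h.map_zero]; exact chart_source_mem G)
    filter_upwards [hs] with t ht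
    exact ((chart G).left_inv ht).symm
  intro t
  have h1 : ContMDiffAt 𝓘(ℝ, ℝ) 𝓘(ℝ, E) ∞ (fun s => γ (s - t)) t := by
    refine ContMDiffAt.comp (f := fun s : ℝ => s - t) t ?_
      ((contDiff_id.sub contDiff_const).contMDiff.contMDiffAt)
    rw [sub_self]
    exact h0
  have h2 := (contMDiff_mul_left (I := 𝓘(ℝ, E)) (n := ∞) (a := γ t)).contMDiffAt.comp t h1
  refine h2.congr_of_eventuallyEq (Filter.Eventually.of_forall fun s => ?_)
  simp only [Function.comp_apply]
  rw [← h.map_add]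
  congr 1
  ring

theorem IsOneParam.conj {γ : ℝ → G} {X : E} (h : IsOneParam γ X) (g : G) :
    IsOneParam (fun t => g * γ t * g⁻¹) (Ad E g X) := by
  refine ⟨fun a b => by rw [h.map_add]; group, ?_⟩
  have h1 : HasMFDerivAt 𝓘(ℝ, E) 𝓘(ℝ, E) (fun x : G => g * x * g⁻¹) (γ 0) (Ad E g) :=
    hasMFDerivAt_of_eq h.map_zero.symm (hasMFDerivAt_conj g)
  have h2 := HasMFDerivAt.comp (0 : ℝ) h1 h.hasMFDerivAt
  have h3 : Ad E g ∘L ((1 : ℝ →L[ℝ] ℝ).smulRight X) = (1 : ℝ →L[ℝ] ℝ).smulRight (Ad E g X) := by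
    ext
    simp
  exact hasMFDerivAt_congr h2 h3

omit [LieGroup 𝓘(ℝ, E) ∞ G] in
theorem IsOneParam.velocity_unique {γ : ℝ → G} {X Y : E} (h : IsOneParam γ X)
    (h' : IsOneParam γ Y) : X = Y :=
  h.hasDerivAt_chart.unique h'.hasDerivAt_chart

theorem IsOneParam.bracket_eq_zero_of_commute {γ δ : ℝ → G} {X Y : E} (h : IsOneParam γ X)
    (h' : IsOneParam δ Y) (hc : ∀ a b, γ a * δ b = δ b * γ a) : tangentBracket G X Y = 0 := by
  have h1 : ∀ a, Ad E (γ a) Y = Y := by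
    intro a
    have h2 := h'.conj (γ a)
    have h3 : (fun t => γ a * δ t * (γ a)⁻¹) = δ := by
      funext t
      rw [hc, mul_inv_cancel_right]
    rw [h3] at h2
    exact h2.velocity_unique h'
  have h2 := h.hasDerivAt_Ad_zero Y
  simp only [h1] at h2
  exact h2.unique (hasDerivAt_const _ _)

theorem IsOneParam.commute_of_bracket_eq_zero [T2Space G] [CompleteSpace E] {γ δ : ℝ → G} {X Y : E}
    (h : IsOneParam γ X) (h' : IsOneParam δ Y) (hb : tangentBracket G X Y = 0) (a b : ℝ) :
    γ a * δ b = δ b * γ a := by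
  have h1 : Ad E (γ a) Y = Ad E (γ 0) Y := by
    refine is_const_of_deriv_eq_zero (𝕜 := ℝ) (f := fun a => Ad E (γ a) Y)
      (fun t => (h.hasDerivAt_Ad Y t).differentiableAt) (fun t => ?_) a 0
    rw [(h.hasDerivAt_Ad Y t).deriv, hb, _root_.map_zero]
  rw [IsOneParam.map_zero h, Ad_one, ContinuousLinearMap.id_apply] at h1
  have h2 := h'.conj (γ a)
  rw [h1] at h2
  have h3 := congrFun (h2.unique h') b
  rw [mul_inv_eq_iff_eq_mul] at h3
  exact h3

end LieGroupChart

/-! ### Consequences of compactness, and centralizers of tori -/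

/-- A real Lie algebra with trivial centre that preserves a positive definite symmetric form has
negative definite Killing form. -/
theorem killingForm_neg_of_invariant_form {L : Type*} [LieRing L] [LieAlgebra ℝ L]
    [FiniteDimensional ℝ L] (B : L →ₗ[ℝ] L →ₗ[ℝ] ℝ) (hsymm : ∀ x y, B x y = B y x)
    (hpos : ∀ x, x ≠ 0 → 0 < B x x) (hinv : ∀ z x y : L, B ⁅z, x⁆ y + B x ⁅z, y⁆ = 0)
    (hc : LieAlgebra.center ℝ L = ⊥) (X : L) (hX : X ≠ 0) : killingForm ℝ L X X < 0 := by
  let c : InnerProductSpace.Core ℝ L :=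
    { inner := fun x y => B x y
      conj_inner_symm := fun x y => by simpa using hsymm y x
      re_inner_nonneg := fun x => by
        rcases eq_or_ne x 0 with rfl | h
        · simp
        · exact (hpos x h).le
      add_left := fun x y z => by simp
      smul_left := fun x y r => by simp
      definite := fun x h => by
        by_contra h'
        exact (hpos x h').ne' h }
  let i1 : NormedAddCommGroup L := c.toNormedAddCommGroup
  let i2 : InnerProductSpace ℝ L := InnerProductSpace.ofCore c.toCore
  let b := stdOrthonormalBasis ℝ L
  have h1 : killingForm ℝ L X X = -∑ i, B ⁅X, b i⁆ ⁅X, b i⁆ := by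
    rw [killingForm_apply_apply, LinearMap.trace_eq_sum_inner _ b, ← Finset.sum_neg_distrib]
    refine Finset.sum_congr rfl fun i _ => ?_
    change B (b i) ⁅X, ⁅X, b i⁆⁆ = _
    linarith [hinv X (b i) ⁅X, b i⁆]
  have h2 : ∀ x, 0 ≤ B x x := fun x => by
    rcases eq_or_ne x 0 with rfl | h
    · simp
    · exact (hpos x h).le
  rw [h1, neg_lt_zero]
  refine lt_of_le_of_ne (Finset.sum_nonneg fun i _ => h2 _) fun h0 => hX ?_
  have h3 := (Finset.sum_eq_zero_iff_of_nonneg fun i _ => h2 ⁅X, b i⁆).1 h0.symm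
  have h4 : ∀ i, ⁅X, b i⁆ = 0 := fun i => by
    by_contra h
    exact (hpos _ h).ne' (h3 i (Finset.mem_univ i))
  have h5 : LieAlgebra.ad ℝ L X = 0 := b.toBasis.ext fun i => by simpa using h4 i
  have h6 : X ∈ LieAlgebra.center ℝ L := by
    rw [LieModule.mem_maxTrivSubmodule]
    intro Y
    rw [← lie_skew]
    have : ⁅X, Y⁆ = 0 := congrArg (fun T => T Y) h5
    rw [this, neg_zero]
  rw [hc] at h6
  simpa using h6

namespace LieGroupChart

variable {E : Type*} [NormedAddCommGroup E] [NormedSpace ℝ E] [FiniteDimensional ℝ E]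
  {G : Type*} [TopologicalSpace G] [ChartedSpace E G] [Group G] [LieGroup 𝓘(ℝ, E) ∞ G]
  [T2Space G] [CompactSpace G]

/-- A compact Lie group preserves an inner product on its Lie algebra, by averaging. -/
theorem exists_Ad_invariant_form : ∃ B : E →ₗ[ℝ] E →ₗ[ℝ] ℝ, (∀ x y, B x y = B y x) ∧
    (∀ x, x ≠ 0 → 0 < B x x) ∧ ∀ (g : G) (x y : E), B (Ad E g x) (Ad E g y) = B x y := by
  have : IsTopologicalGroup G := topologicalGroup_of_lieGroup 𝓘(ℝ, E) ∞
  let _ : MeasurableSpace G := borel G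
  have : BorelSpace G := ⟨rfl⟩
  let μ : Measure G := Measure.haar
  let F : E → E → G → ℝ := fun x y g =>
    inner ℝ (toEuclidean (Ad E g⁻¹ x)) (toEuclidean (Ad E g⁻¹ y))
  have hcont : ∀ x y, Continuous (F x y) := by
    intro x y
    have h : ∀ x : E, Continuous fun g : G => toEuclidean (Ad E g⁻¹ x) := fun x =>
      toEuclidean.continuous.comp ((continuous_Ad E x).comp continuous_inv)
    exact (h x).inner (h y)
  have hint : ∀ x y, Integrable (F x y) μ := fun x y =>
    (hcont x y).integrable_of_hasCompactSupport (HasCompactSupport.of_compactSpace _)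
  let B : E →ₗ[ℝ] E →ₗ[ℝ] ℝ := LinearMap.mk₂ ℝ (fun x y => ∫ g, F x y g ∂μ)
    (fun x x' y => by
      rw [← integral_add (hint _ _) (hint _ _)]
      congr 1; funext g; simp [F, inner_add_left])
    (fun c x y => by
      rw [smul_eq_mul, ← integral_const_mul]
      congr 1; funext g; simp [F, inner_smul_left])
    (fun x y y' => by
      rw [← integral_add (hint _ _) (hint _ _)]
      congr 1; funext g; simp [F, inner_add_right])
    (fun c x y => by
      rw [smul_eq_mul, ← integral_const_mul]
      congr 1; funext g; simp [F, inner_smul_right])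
  refine ⟨B, fun x y => ?_, fun x hx => ?_, fun h x y => ?_⟩
  · change ∫ g, F x y g ∂μ = ∫ g, F y x g ∂μ
    congr 1; funext g; exact real_inner_comm _ _
  · change 0 < ∫ g, F x x g ∂μ
    refine (hcont x x).integral_pos_of_hasCompactSupport_nonneg_nonzero
      (HasCompactSupport.of_compactSpace _) (fun g => real_inner_self_nonneg) (x := 1) ?_
    simp [F, Ad_one, hx]
  · change ∫ g, F (Ad E h x) (Ad E h y) g ∂μ = ∫ g, F x y g ∂μ
    rw [← integral_mul_left_eq_self (F x y) h⁻¹]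
    congr 1; funext g
    have : ∀ z : E, Ad E g⁻¹ (Ad E h z) = Ad E (h⁻¹ * g)⁻¹ z := fun z => by
      rw [mul_inv_rev, inv_inv, Ad_mul]; rfl
    simp only [F, this]

/-- Differentiating the invariance of an inner product under `Ad` along a one-parameter subgroup
shows that `ad` is skew. -/
theorem exists_bracket_invariant_form : ∃ B : E →ₗ[ℝ] E →ₗ[ℝ] ℝ, (∀ x y, B x y = B y x) ∧
    (∀ x, x ≠ 0 → 0 < B x x) ∧
    ∀ z x y : E, B (tangentBracket G z x) y + B x (tangentBracket G z y) = 0 := by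
  have : CompleteSpace E := FiniteDimensional.complete ℝ E
  obtain ⟨B, hs, hp, hi⟩ := exists_Ad_invariant_form (E := E) (G := G)
  refine ⟨B, hs, hp, fun z x y => ?_⟩
  obtain ⟨γ, hγ⟩ := exists_isOneParam (G := G) z
  have h1 := ContinuousLinearMap.hasDerivAt_of_bilinear (B := B.toContinuousBilinearMap)
    (fun _ => hγ.hasDerivAt_Ad_zero x) (fun _ => hγ.hasDerivAt_Ad_zero y)
  have h2 : (fun t => B.toContinuousBilinearMap (Ad E (γ t) x) (Ad E (γ t) y)) =
      fun _ => B x y := by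
    funext t
    exact hi (γ t) x y
  rw [h2] at h1
  have h3 := h1.unique (hasDerivAt_const _ _)
  simp only [hγ.map_zero, Ad_one, ContinuousLinearMap.id_apply] at h3
  rw [add_comm]
  exact h3

end LieGroupChart

open LieGroupChart

section

variable {E : Type*} [NormedAddCommGroup E] [NormedSpace ℝ E] [FiniteDimensional ℝ E]
  {G : Type*} [TopologicalSpace G] [ChartedSpace E G] [Group G] [LieGroup 𝓘(ℝ, E) ∞ G]
  [T2Space G]

instance groupLieAlgebra_finiteDimensional : FiniteDimensional ℝ (GroupLieAlgebra 𝓘(ℝ, E) G) :=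
  inferInstanceAs (FiniteDimensional ℝ E)

/-- The Killing form of a compact Lie group with simple Lie algebra is negative definite. -/
theorem killingForm_neg_of_compact [CompleteSpace E] [CompactSpace G]
    [LieAlgebra.IsSimple ℝ (GroupLieAlgebra 𝓘(ℝ, E) G)]
    (X : GroupLieAlgebra 𝓘(ℝ, E) G) (hX : X ≠ 0) :
    killingForm ℝ (GroupLieAlgebra 𝓘(ℝ, E) G) X X < 0 := by
  obtain ⟨B, hs, hp, hi⟩ := exists_bracket_invariant_form (E := E) (G := G)
  exact killingForm_neg_of_invariant_form (L := GroupLieAlgebra 𝓘(ℝ, E) G) B hs hp hi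
    (LieAlgebra.center_eq_bot ℝ _) X hX

omit [FiniteDimensional ℝ E] [T2Space G] in
theorem isOneParameterVelocity_iff (K : Subgroup G)
    (X : GroupLieAlgebra 𝓘(ℝ, E) G) :
    IsOneParameterVelocity K X ↔ ∃ γ : ℝ → G, IsOneParam (E := E) γ X ∧ ∀ a, γ a ∈ K := by
  constructor
  · rintro ⟨γ, h1, h2, h3, h4⟩
    refine ⟨γ, ⟨h2, ?_⟩, h3⟩
    have h5 := ((h1.mdifferentiable (by simp)) 0).hasMFDerivAt
    let D : ℝ →L[ℝ] E := mfderiv 𝓘(ℝ, ℝ) 𝓘(ℝ, E) γ 0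
    have h6 : D 1 = X := by
      have h0 : γ 0 = 1 := by simpa using h2 0 0
      have : ∀ p q : TangentBundle 𝓘(ℝ, E) G, p = q → (p.2 : E) = (q.2 : E) := by
        rintro p _ rfl; rfl
      exact this _ _ h4
    have h7 : D = (1 : ℝ →L[ℝ] ℝ).smulRight (D 1) := by
      ext
      simp
    exact hasMFDerivAt_congr (A := D) h5
      (h7.trans (congrArg (fun v : E => (1 : ℝ →L[ℝ] ℝ).smulRight v) h6))
  · rintro ⟨γ, h, hK⟩
    refine ⟨γ, h.contMDiff, h.map_add, hK, ?_⟩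
    have h1 : (mfderiv 𝓘(ℝ, ℝ) 𝓘(ℝ, E) γ 0 : ℝ →L[ℝ] E) = (1 : ℝ →L[ℝ] ℝ).smulRight X :=
      h.hasMFDerivAt.mfderiv
    have h2 : ∀ (g : G) (v : E), g = 1 → v = X →
        (⟨g, v⟩ : TangentBundle 𝓘(ℝ, E) G) = ⟨1, X⟩ := by
      rintro _ _ rfl rfl; rfl
    refine h2 _ _ h.map_zero ?_
    exact (congrArg (fun T : ℝ →L[ℝ] E => T 1) h1).trans (one_smul ℝ (X : E))

omit [FiniteDimensional ℝ E] [LieGroup 𝓘(ℝ, E) ∞ G] [T2Space G] in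
/-- The one-parameter subgroup of a torus in the direction `v`. -/
theorem isOneParam_of_smooth_hom {n : ℕ} {f : (Fin n → ℝ) → G}
    (hf : ContMDiff 𝓘(ℝ, Fin n → ℝ) 𝓘(ℝ, E) ∞ f) (hadd : ∀ v w, f (v + w) = f v * f w)
    (v : Fin n → ℝ) : ∃ Y : E, IsOneParam (fun t : ℝ => f (t • v)) Y := by
  have h1 : ContMDiff 𝓘(ℝ, ℝ) 𝓘(ℝ, E) ∞ (fun t : ℝ => f (t • v)) :=
    hf.comp (contDiff_id.smul contDiff_const).contMDiff
  have h5 := ((h1.mdifferentiable (by simp)) 0).hasMFDerivAt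
  let D : ℝ →L[ℝ] E := mfderiv 𝓘(ℝ, ℝ) 𝓘(ℝ, E) (fun t : ℝ => f (t • v)) 0
  refine ⟨D 1, fun a b => by rw [add_smul, hadd], ?_⟩
  have h7 : D = (1 : ℝ →L[ℝ] ℝ).smulRight (D 1) := by
    ext
    simp
  exact hasMFDerivAt_congr (A := D) h5 h7

omit [FiniteDimensional ℝ E] in
/-- The Lie algebra of the centralizer `K` of a torus `S` contains the centralizer of its own
centre: the one-parameter subgroups of `S` have velocities in this centre, and one-parameter subgroups with
commuting velocities commute. -/
theorem mem_lieAlgebra_of_commute_centre [CompleteSpace E] {S K : Subgroup G}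
    (hS : IsTorus (E := E) S) (hK : K = Subgroup.centralizer (S : Set G))
    (X : GroupLieAlgebra 𝓘(ℝ, E) G)
    (hX : ∀ H ∈ FlagManifold.centre (Subgroup.lieAlgebra (E := E) K), ⁅X, H⁆ = 0) :
    X ∈ Subgroup.lieAlgebra (E := E) K := by
  obtain ⟨n, f, hf, hadd, -, hrange⟩ := hS
  have hfS : ∀ v, f v ∈ S := fun v => by
    have : f v ∈ (S : Set G) := hrange ▸ Set.mem_range_self v
    exact this
  have hcomm : ∀ v w, f v * f w = f w * f v := fun v w => by
    rw [← hadd, ← hadd, add_comm]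
  have hfK : ∀ v, f v ∈ K := fun v => by
    rw [hK, Subgroup.mem_centralizer_iff]
    intro s hs
    rw [← hrange] at hs
    obtain ⟨w, rfl⟩ := hs
    exact hcomm w v
  obtain ⟨γ, hγ⟩ := exists_isOneParam (G := G) (E := E) X
  refine LieSubalgebra.subset_lieSpan ((isOneParameterVelocity_iff K X).2 ⟨γ, hγ, fun a => ?_⟩)
  rw [hK, Subgroup.mem_centralizer_iff]
  intro s hs
  rw [← hrange] at hs
  obtain ⟨v, rfl⟩ := hs
  obtain ⟨Y, hY⟩ : ∃ Y : GroupLieAlgebra 𝓘(ℝ, E) G,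
      IsOneParam (E := E) (fun t : ℝ => f (t • v)) Y :=
    isOneParam_of_smooth_hom (E := E) hf hadd v
  have hYK : Y ∈ Subgroup.lieAlgebra (E := E) K :=
    LieSubalgebra.subset_lieSpan ((isOneParameterVelocity_iff K Y).2 ⟨_, hY, fun a => hfK _⟩)
  have hYc : ∀ Z ∈ Subgroup.lieAlgebra (E := E) K,
      ⁅Z, Y⁆ = 0 := by
    intro Z hZ
    induction hZ using LieSubalgebra.lieSpan_induction with
    | mem Z hZ =>
      obtain ⟨δ, hδ, hδK⟩ := (isOneParameterVelocity_iff K Z).1 hZ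
      refine hδ.bracket_eq_zero_of_commute hY fun a b => ?_
      have := hδK a
      rw [hK, Subgroup.mem_centralizer_iff] at this
      exact (this _ (hfS _)).symm
    | zero => exact zero_lie _
    | add Z W _ _ h1 h2 => rw [add_lie, h1, h2, add_zero]
    | smul c Z _ h1 => rw [smul_lie, h1, smul_zero]
    | lie Z W _ _ h1 h2 => rw [lie_lie, h1, h2, lie_zero, lie_zero, sub_zero]
  have hYcentre : Y ∈
      FlagManifold.centre (Subgroup.lieAlgebra (E := E) K) := by
    refine ⟨⟨Y, hYK⟩, ?_, rfl⟩
    refine (LieModule.mem_maxTrivSubmodule _ _ _ _).2 fun Z => ?_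
    exact Subtype.ext (hYc Z Z.2)
  have h := hγ.commute_of_bracket_eq_zero hY (hX _ hYcentre) a 1
  simpa using h.symm

end

end LieGroups

/-! ### The complexification and its hermitian form -/

namespace FlagManifold

variable {L : Type*} [LieRing L] [LieAlgebra ℝ L]

/-! The bracket of `ℂ ⊗ 𝔤` is found through the extension of scalars of modules rather than through
its Lie ring structure; the two agree by unfolding, and the rules below are the usual ones, stated
for the first. -/

section Bracket

variable (c : ℂ) (x y z : ℂ ⊗[ℝ] L)

theorem cx_add_lie : ⁅x + y, z⁆ = ⁅x, z⁆ + ⁅y, z⁆ := add_lie x y z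

theorem cx_lie_add : ⁅x, y + z⁆ = ⁅x, y⁆ + ⁅x, z⁆ := lie_add x y z

theorem cx_smul_lie : ⁅c • x, y⁆ = c • ⁅x, y⁆ := smul_lie c x y

theorem cx_lie_smul : ⁅x, c • y⁆ = c • ⁅x, y⁆ := lie_smul c x y

theorem cx_zero_lie : ⁅(0 : ℂ ⊗[ℝ] L), x⁆ = 0 := zero_lie x

theorem cx_lie_zero : ⁅x, (0 : ℂ ⊗[ℝ] L)⁆ = 0 := lie_zero x

theorem cx_lie_skew : -⁅y, x⁆ = ⁅x, y⁆ := lie_skew x y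

theorem cx_lie_lie : ⁅x, ⁅y, z⁆⁆ = ⁅⁅x, y⁆, z⁆ + ⁅y, ⁅x, z⁆⁆ := leibniz_lie x y z

theorem cx_sum_lie {ι : Type*} (s : Finset ι) (f : ι → ℂ ⊗[ℝ] L) :
    ⁅∑ i ∈ s, f i, x⁆ = ∑ i ∈ s, ⁅f i, x⁆ :=
  sum_lie s f x

theorem cx_lie_sum {ι : Type*} (s : Finset ι) (f : ι → ℂ ⊗[ℝ] L) :
    ⁅x, ∑ i ∈ s, f i⁆ = ∑ i ∈ s, ⁅x, f i⁆ :=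
  lie_sum s f x

end Bracket

/-- The complex conjugation `τ` of `𝔤^ℂ = ℂ ⊗ 𝔤` with respect to `𝔤`. -/
def conjugation (L : Type*) [LieRing L] [LieAlgebra ℝ L] : ℂ ⊗[ℝ] L →ₗ[ℝ] ℂ ⊗[ℝ] L :=
  LinearMap.rTensor L Complex.conjAe.toLinearMap

local notation "τ" => conjugation _

@[simp] theorem conjugation_tmul (a : ℂ) (x : L) :
    τ (a ⊗ₜ[ℝ] x) = (starRingEnd ℂ a) ⊗ₜ x := rfl

theorem conjugation_smul (c : ℂ) (x : ℂ ⊗[ℝ] L) : τ (c • x) = (starRingEnd ℂ c) • τ x := by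
  induction x with
  | zero => simp
  | tmul a x => simp [TensorProduct.smul_tmul']
  | add x y hx hy => simp only [smul_add, map_add, hx, hy]

@[simp] theorem conjugation_conjugation (x : ℂ ⊗[ℝ] L) : τ (τ x) = x := by
  induction x with
  | zero => simp
  | tmul a x => simp
  | add x y hx hy => simp only [map_add, hx, hy]

theorem exists_real_add_imaginary (z : ℂ ⊗[ℝ] L) :
    ∃ a b : L, z = 1 ⊗ₜ a + Complex.I • (1 ⊗ₜ[ℝ] b) := by
  induction z with
  | zero => exact ⟨0, 0, by simp⟩
  | add x y hx hy =>
    obtain ⟨a, b, rfl⟩ := hx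
    obtain ⟨a', b', rfl⟩ := hy
    exact ⟨a + a', b + b', by simp only [TensorProduct.tmul_add, smul_add]; abel⟩
  | tmul c x =>
    refine ⟨c.re • x, c.im • x, ?_⟩
    rw [TensorProduct.tmul_smul, TensorProduct.tmul_smul, TensorProduct.smul_tmul',
      TensorProduct.smul_tmul', TensorProduct.smul_tmul', ← TensorProduct.add_tmul]
    congr 1
    apply Complex.ext <;> simp

theorem lie_one_tmul (x y : L) : ⁅(1 : ℂ) ⊗ₜ[ℝ] x, (1 : ℂ) ⊗ₜ[ℝ] y⁆ = 1 ⊗ₜ ⁅x, y⁆ := by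
  rw [LieAlgebra.ExtendScalars.bracket_tmul, one_mul]

theorem conjugation_lie (x y : ℂ ⊗[ℝ] L) : τ ⁅x, y⁆ = ⁅τ x, τ y⁆ := by
  obtain ⟨a, b, rfl⟩ := exists_real_add_imaginary x
  obtain ⟨a', b', rfl⟩ := exists_real_add_imaginary y
  simp only [cx_add_lie, cx_lie_add, cx_smul_lie, cx_lie_smul, map_add, conjugation_smul,
    lie_one_tmul, conjugation_tmul, map_one]

theorem tmul_one_injective : Function.Injective fun x : L => (1 : ℂ) ⊗ₜ[ℝ] x :=
  Module.Flat.rTensor_preserves_injective_linearMap (M := L)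
    (Algebra.linearMap ℝ ℂ) (algebraMap ℝ ℂ).injective |>.comp
    (TensorProduct.lid ℝ L).symm.injective |> fun h => by
      intro x y hxy
      apply h
      simpa using hxy

section Form

variable [FiniteDimensional ℝ L]

theorem killingForm_tmul (a b : ℂ) (x y : L) :
    killingForm ℂ (ℂ ⊗[ℝ] L) (a ⊗ₜ x) (b ⊗ₜ y) = a * b * (killingForm ℝ L x y : ℂ) := by
  have h : killingForm ℂ (ℂ ⊗[ℝ] L) = (killingForm ℝ L).baseChange ℂ :=
    LieModule.traceForm_baseChange (R := ℝ) (L := L) (M := L) (A := ℂ)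
  rw [h, LinearMap.BilinForm.baseChange_tmul]
  simp [Algebra.smul_def]; ring

theorem killingForm_conjugation (x y : ℂ ⊗[ℝ] L) :
    killingForm ℂ (ℂ ⊗[ℝ] L) (τ x) (τ y) = starRingEnd ℂ (killingForm ℂ (ℂ ⊗[ℝ] L) x y) := by
  induction x with
  | zero => simp
  | add x x' hx hx' => simp only [map_add, LinearMap.add_apply, hx, hx']
  | tmul a x =>
    induction y with
    | zero => simp
    | add y y' hy hy' => simp only [map_add, hy, hy']
    | tmul b y => simp only [conjugation_tmul, killingForm_tmul, map_mul, Complex.conj_ofReal]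

omit [FiniteDimensional ℝ L] in
theorem killingForm_comm (x y : ℂ ⊗[ℝ] L) :
    killingForm ℂ (ℂ ⊗[ℝ] L) x y = killingForm ℂ (ℂ ⊗[ℝ] L) y x :=
  LieModule.traceForm_comm ℂ _ _ x y

omit [FiniteDimensional ℝ L] in
theorem killingForm_lie (x y z : ℂ ⊗[ℝ] L) :
    killingForm ℂ (ℂ ⊗[ℝ] L) ⁅x, y⁆ z = killingForm ℂ (ℂ ⊗[ℝ] L) x ⁅y, z⁆ :=
  LieModule.traceForm_apply_lie_apply ℂ _ _ x y z

/-- The hermitian form `⟨x, y⟩ = -φ(τ x, y)` on `𝔤^ℂ`, conjugate linear in the first variable. -/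
def herm (x y : ℂ ⊗[ℝ] L) : ℂ := -killingForm ℂ (ℂ ⊗[ℝ] L) (τ x) y

theorem herm_conj (x y : ℂ ⊗[ℝ] L) : starRingEnd ℂ (herm y x) = herm x y := by
  rw [herm, herm, map_neg, ← killingForm_conjugation, conjugation_conjugation, killingForm_comm]

omit [FiniteDimensional ℝ L] in
theorem herm_add_left (x y z : ℂ ⊗[ℝ] L) : herm (x + y) z = herm x z + herm y z := by
  simp only [herm, map_add, LinearMap.add_apply, neg_add]

omit [FiniteDimensional ℝ L] in
theorem herm_add_right (x y z : ℂ ⊗[ℝ] L) : herm z (x + y) = herm z x + herm z y := by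
  simp only [herm, map_add, neg_add]

theorem herm_smul_left (c : ℂ) (x y : ℂ ⊗[ℝ] L) :
    herm (c • x) y = starRingEnd ℂ c * herm x y := by
  simp [herm, conjugation_smul]

theorem herm_smul_right (c : ℂ) (x y : ℂ ⊗[ℝ] L) : herm x (c • y) = c * herm x y := by
  simp [herm]

omit [FiniteDimensional ℝ L] in
/-- The adjoint of `ad u` is `-ad (τ u)`; in particular `ad X` is skew-hermitian for `X ∈ 𝔤`. -/
theorem herm_lie_left (u x y : ℂ ⊗[ℝ] L) : herm ⁅u, x⁆ y = -herm x ⁅τ u, y⁆ := by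
  rw [herm, herm, conjugation_lie, ← killingForm_lie, ← cx_lie_skew (τ u) (τ x), map_neg,
    LinearMap.neg_apply]

theorem herm_self (a b : L) :
    herm (1 ⊗ₜ a + Complex.I • (1 ⊗ₜ[ℝ] b)) (1 ⊗ₜ a + Complex.I • (1 ⊗ₜ[ℝ] b)) =
      ((-(killingForm ℝ L a a + killingForm ℝ L b b) : ℝ) : ℂ) := by
  have h : killingForm ℝ L a b = killingForm ℝ L b a := LieModule.traceForm_comm ℝ _ _ a b
  have hI : Complex.I * Complex.I = -1 := Complex.I_mul_I
  simp only [herm, map_add, conjugation_smul, conjugation_tmul, map_one, Complex.conj_I,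
    LinearMap.add_apply, map_smul, LinearMap.smul_apply, killingForm_tmul, h, smul_eq_mul]
  push_cast
  linear_combination ((killingForm ℝ L b b : ℝ) : ℂ) * hI

variable (hneg : ∀ X : L, X ≠ 0 → killingForm ℝ L X X < 0)
include hneg

omit [FiniteDimensional ℝ L] in
theorem killingForm_nonpos (X : L) : killingForm ℝ L X X ≤ 0 := by
  rcases eq_or_ne X 0 with rfl | h
  · simp
  · exact (hneg X h).le

theorem herm_self_re_nonneg (x : ℂ ⊗[ℝ] L) : 0 ≤ (herm x x).re := by
  obtain ⟨a, b, rfl⟩ := exists_real_add_imaginary x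
  rw [herm_self, Complex.ofReal_re]
  linarith [killingForm_nonpos hneg a, killingForm_nonpos hneg b]

theorem eq_zero_of_herm_self (x : ℂ ⊗[ℝ] L) (h : herm x x = 0) : x = 0 := by
  obtain ⟨a, b, rfl⟩ := exists_real_add_imaginary x
  rw [herm_self, Complex.ofReal_eq_zero] at h
  have ha : a = 0 := by
    by_contra ha
    linarith [hneg a ha, killingForm_nonpos hneg b]
  have hb : b = 0 := by
    by_contra hb
    linarith [hneg b hb, killingForm_nonpos hneg a]
  simp [ha, hb]

/-- When the Killing form of `𝔤` is negative definite, `herm` is an inner product on `𝔤^ℂ`. -/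
@[reducible] def hermCore : InnerProductSpace.Core ℂ (ℂ ⊗[ℝ] L) where
  inner := herm
  conj_inner_symm := herm_conj
  re_inner_nonneg := herm_self_re_nonneg hneg
  add_left := herm_add_left
  smul_left x y c := herm_smul_left c x y
  definite := eq_zero_of_herm_self hneg

end Form

/-! ### Weight spaces of commutative subspaces -/

section

/-- The simultaneous eigenspace `{x ∈ 𝔤^ℂ : [H, x] = ξ(H) x for all H ∈ 𝔞}`. The weight `ξ` is an
arbitrary function; it is automatically linear and imaginary valued if the space is nonzero. -/
def weightSpace (𝔞 : Submodule ℝ L) (ξ : 𝔞 → ℂ) : Submodule ℂ (ℂ ⊗[ℝ] L) where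
  carrier := {x | ∀ H : 𝔞, ⁅(1 : ℂ) ⊗ₜ[ℝ] (H : L), x⁆ = ξ H • x}
  add_mem' hx hy H := by rw [cx_lie_add, hx H, hy H, smul_add]
  zero_mem' H := by rw [cx_lie_zero, smul_zero]
  smul_mem' c x hx H := by rw [cx_lie_smul, hx H, smul_comm]

variable {𝔞 : Submodule ℝ L} {ξ η : 𝔞 → ℂ} {x y : ℂ ⊗[ℝ] L}

theorem lie_mem_weightSpace (hx : x ∈ weightSpace 𝔞 ξ) (hy : y ∈ weightSpace 𝔞 η) :
    ⁅x, y⁆ ∈ weightSpace 𝔞 (ξ + η) := fun H => by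
  rw [cx_lie_lie, hx H, hy H, cx_smul_lie, cx_lie_smul, ← add_smul, Pi.add_apply]

theorem lie_mem_weightSpace_of_add {ζ : 𝔞 → ℂ} (hx : x ∈ weightSpace 𝔞 ξ)
    (hy : y ∈ weightSpace 𝔞 η) (h : ξ + η = ζ) : ⁅x, y⁆ ∈ weightSpace 𝔞 ζ :=
  h ▸ lie_mem_weightSpace hx hy

theorem exists_linear_weight (hx : x ∈ weightSpace 𝔞 ξ) (hx0 : x ≠ 0) :
    ∃ ξ' : 𝔞 →ₗ[ℝ] ℂ, ⇑ξ' = ξ := by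
  have key : ∀ a b : ℂ, a • x = b • x → a = b := fun a b h => smul_left_injective ℂ hx0 h
  refine ⟨⟨⟨ξ, fun H H' => key _ _ ?_⟩, fun r H => key _ _ ?_⟩, rfl⟩
  · rw [← hx, Submodule.coe_add, TensorProduct.tmul_add, cx_add_lie, hx, hx, add_smul]
  · have h : (1 : ℂ) ⊗ₜ[ℝ] ((r • H : 𝔞) : L) = (r : ℂ) • ((1 : ℂ) ⊗ₜ[ℝ] (H : L)) := by
      rw [TensorProduct.smul_tmul', Submodule.coe_smul, TensorProduct.tmul_smul,
        TensorProduct.smul_tmul', Complex.real_smul, smul_eq_mul]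
    change ξ (r • H) • x = (r • ξ H) • x
    rw [← hx, h, cx_smul_lie, hx, smul_smul, Complex.real_smul]

variable [FiniteDimensional ℝ L]

variable (hneg : ∀ X : L, X ≠ 0 → killingForm ℝ L X X < 0)
include hneg

/-- Weights are imaginary valued, as `ad X` is skew-hermitian for `X ∈ 𝔤`. -/
theorem weight_conj (hx : x ∈ weightSpace 𝔞 ξ) (hx0 : x ≠ 0) (H : 𝔞) :
    starRingEnd ℂ (ξ H) = -ξ H := by
  have h := herm_lie_left ((1 : ℂ) ⊗ₜ[ℝ] (H : L)) x x
  rw [conjugation_tmul, map_one, hx H, herm_smul_left, herm_smul_right, ← neg_mul] at h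
  exact mul_right_cancel₀ (fun h0 => hx0 (eq_zero_of_herm_self hneg x h0)) h

theorem herm_eq_zero_of_weight_ne (hx : x ∈ weightSpace 𝔞 ξ) (hy : y ∈ weightSpace 𝔞 η)
    (hne : ξ ≠ η) : herm x y = 0 := by
  rcases eq_or_ne x 0 with rfl | hx0
  · simp [herm]
  obtain ⟨H, hH⟩ := Function.ne_iff.1 hne
  have h := herm_lie_left ((1 : ℂ) ⊗ₜ[ℝ] (H : L)) x y
  rw [conjugation_tmul, map_one, hx H, hy H, herm_smul_left, herm_smul_right,
    weight_conj hneg hx hx0] at h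
  have h' : (ξ H - η H) * herm x y = 0 := by linear_combination -h
  exact (mul_eq_zero.1 h').resolve_left (sub_ne_zero.2 hH)

theorem conjugation_mem_weightSpace (hx : x ∈ weightSpace 𝔞 ξ) :
    τ x ∈ weightSpace 𝔞 (-ξ) := by
  rcases eq_or_ne x 0 with rfl | hx0
  · simp
  intro H
  have h := congrArg (conjugation L) (hx H)
  rwa [conjugation_lie, conjugation_tmul, map_one, conjugation_smul, weight_conj hneg hx hx0] at h

/-- Simultaneous diagonalization of a commutative subspace `𝔞` of `𝔤` on a stable subspace of `𝔤^ℂ`,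
by applying the spectral theorem to the commuting hermitian operators `i ad H`. -/
theorem le_iSup_inf_weightSpace (h𝔞 : ∀ X ∈ 𝔞, ∀ Y ∈ 𝔞, ⁅X, Y⁆ = 0)
    (V : Submodule ℂ (ℂ ⊗[ℝ] L))
    (hV : ∀ H : 𝔞, ∀ x ∈ V, ⁅(1 : ℂ) ⊗ₜ[ℝ] (H : L), x⁆ ∈ V) :
    V ≤ ⨆ ξ : 𝔞 → ℂ, V ⊓ weightSpace 𝔞 ξ := by
  let c := hermCore hneg
  let i1 : NormedAddCommGroup (ℂ ⊗[ℝ] L) := c.toNormedAddCommGroup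
  let i2 : InnerProductSpace ℂ (ℂ ⊗[ℝ] L) := InnerProductSpace.ofCore c.toCore
  let T : 𝔞 → V →ₗ[ℂ] V := fun H =>
    { toFun := fun x => ⟨Complex.I • ⁅(1 : ℂ) ⊗ₜ[ℝ] (H : L), (x : ℂ ⊗[ℝ] L)⁆,
        V.smul_mem _ (hV H x x.2)⟩
      map_add' := fun x y => Subtype.ext <| by
        change Complex.I • ⁅_, (x : ℂ ⊗[ℝ] L) + y⁆ = _
        rw [cx_lie_add, smul_add]; rfl
      map_smul' := fun r x => Subtype.ext <| by
        change Complex.I • ⁅_, r • (x : ℂ ⊗[ℝ] L)⁆ = _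
        rw [cx_lie_smul, smul_comm]; rfl }
  have hT : ∀ H, (T H).IsSymmetric := fun H x y => by
    change herm (Complex.I • ⁅(1 : ℂ) ⊗ₜ[ℝ] (H : L), (x : ℂ ⊗[ℝ] L)⁆) y =
      herm (x : ℂ ⊗[ℝ] L) (Complex.I • ⁅(1 : ℂ) ⊗ₜ[ℝ] (H : L), (y : ℂ ⊗[ℝ] L)⁆)
    rw [herm_smul_left, herm_smul_right, herm_lie_left, conjugation_tmul, map_one, Complex.conj_I]
    ring
  have hc : Pairwise (Function.onFun Commute T) := fun H H' _ => by
    refine LinearMap.ext fun x => Subtype.ext ?_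
    change
      Complex.I • ⁅(1 : ℂ) ⊗ₜ[ℝ] (H : L), Complex.I • ⁅(1 : ℂ) ⊗ₜ[ℝ] (H' : L), (x : ℂ ⊗[ℝ] L)⁆⁆ =
      Complex.I • ⁅(1 : ℂ) ⊗ₜ[ℝ] (H' : L), Complex.I • ⁅(1 : ℂ) ⊗ₜ[ℝ] (H : L), (x : ℂ ⊗[ℝ] L)⁆⁆
    rw [cx_lie_smul, cx_lie_smul, cx_lie_lie, lie_one_tmul, h𝔞 H H.2 H' H'.2,
      TensorProduct.tmul_zero, cx_zero_lie, zero_add]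
  have h := LinearMap.IsSymmetric.iSup_iInf_eq_top_of_commute hT hc
  calc V = (⊤ : Submodule ℂ V).map V.subtype := by simp
    _ ≤ _ := by
      rw [← h, Submodule.map_iSup]
      refine iSup_le fun χ => ?_
      rintro _ ⟨x, hx, rfl⟩
      refine Submodule.mem_iSup_of_mem (fun H => -Complex.I * χ H) ⟨x.2, fun H => ?_⟩
      have h1 := Module.End.mem_eigenspace_iff.1 ((Submodule.mem_iInf _).1 hx H)
      have h2 : Complex.I • ⁅(1 : ℂ) ⊗ₜ[ℝ] (H : L), (x : ℂ ⊗[ℝ] L)⁆ = χ H • (x : ℂ ⊗[ℝ] L) :=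
        congrArg Subtype.val h1
      change ⁅(1 : ℂ) ⊗ₜ[ℝ] (H : L), (x : ℂ ⊗[ℝ] L)⁆ = (-Complex.I * χ H) • (x : ℂ ⊗[ℝ] L)
      rw [mul_smul, ← h2, smul_smul, neg_mul, Complex.I_mul_I, neg_neg, one_smul]

theorem exists_inf_weightSpace_ne_bot (h𝔞 : ∀ X ∈ 𝔞, ∀ Y ∈ 𝔞, ⁅X, Y⁆ = 0)
    (V : Submodule ℂ (ℂ ⊗[ℝ] L))
    (hV : ∀ H : 𝔞, ∀ x ∈ V, ⁅(1 : ℂ) ⊗ₜ[ℝ] (H : L), x⁆ ∈ V) (hV0 : V ≠ ⊥) :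
    ∃ ξ : 𝔞 →ₗ[ℝ] ℂ, V ⊓ weightSpace 𝔞 ξ ≠ ⊥ := by
  by_contra! h
  refine hV0 (eq_bot_iff.2 ((le_iSup_inf_weightSpace hneg h𝔞 V hV).trans (iSup_le fun ξ => ?_)))
  rintro x ⟨hx, hxξ⟩
  by_contra hx0
  obtain ⟨ξ', rfl⟩ := exists_linear_weight hxξ hx0
  have : x ∈ V ⊓ weightSpace 𝔞 ξ' := ⟨hx, hxξ⟩
  rw [h] at this
  exact hx0 this

end

/-! ### Weights of the centre of a subalgebra -/

section

theorem eq_zero_of_real_add_imaginary {a b : L}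
    (h : (1 : ℂ) ⊗ₜ[ℝ] a + Complex.I • ((1 : ℂ) ⊗ₜ[ℝ] b) = 0) : a = 0 ∧ b = 0 := by
  have h' := congrArg (conjugation L) h
  rw [map_add, conjugation_smul, conjugation_tmul, conjugation_tmul, map_one, Complex.conj_I,
    map_zero, neg_smul] at h'
  have h1 : (2 : ℂ) • ((1 : ℂ) ⊗ₜ[ℝ] a) = 0 := by
    rw [two_smul]
    calc _ = ((1 : ℂ) ⊗ₜ[ℝ] a + Complex.I • ((1 : ℂ) ⊗ₜ[ℝ] b)) +
          ((1 : ℂ) ⊗ₜ[ℝ] a + -(Complex.I • ((1 : ℂ) ⊗ₜ[ℝ] b))) := by abel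
      _ = 0 := by rw [h, h', add_zero]
  have h2 : (1 : ℂ) ⊗ₜ[ℝ] a = 0 := (smul_eq_zero.1 h1).resolve_left two_ne_zero
  rw [h2, zero_add] at h
  have h3 : (1 : ℂ) ⊗ₜ[ℝ] b = 0 := (smul_eq_zero.1 h).resolve_left Complex.I_ne_zero
  exact ⟨tmul_one_injective (h2.trans (TensorProduct.tmul_zero _ _).symm),
    tmul_one_injective (h3.trans (TensorProduct.tmul_zero _ _).symm)⟩

theorem lie_real_add_imaginary (k a b : L) :
    ⁅(1 : ℂ) ⊗ₜ[ℝ] k, (1 : ℂ) ⊗ₜ[ℝ] a + Complex.I • ((1 : ℂ) ⊗ₜ[ℝ] b)⁆ =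
      (1 : ℂ) ⊗ₜ[ℝ] ⁅k, a⁆ + Complex.I • ((1 : ℂ) ⊗ₜ[ℝ] ⁅k, b⁆) := by
  rw [cx_lie_add, cx_lie_smul, lie_one_tmul, lie_one_tmul]

variable {𝔨 : LieSubalgebra ℝ L}

theorem mem_centre {H : L} : H ∈ centre 𝔨 ↔ H ∈ 𝔨 ∧ ∀ k ∈ 𝔨, ⁅k, H⁆ = 0 := by
  constructor
  · rintro ⟨X, hX, rfl⟩
    refine ⟨X.2, fun k hk => ?_⟩
    have h := (LieModule.mem_maxTrivSubmodule (R := ℝ) (L := 𝔨) (M := 𝔨) X).1 hX ⟨k, hk⟩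
    simpa using congrArg Subtype.val h
  · rintro ⟨h1, h2⟩
    refine ⟨⟨H, h1⟩, (LieModule.mem_maxTrivSubmodule (R := ℝ) (L := 𝔨) (M := 𝔨) _).2 ?_, rfl⟩
    exact fun k => Subtype.ext (h2 k k.2)

theorem centre_abelian : ∀ X ∈ centre 𝔨, ∀ Y ∈ centre 𝔨, ⁅X, Y⁆ = 0 := fun _ hX _ hY =>
  (mem_centre.1 hY).2 _ (mem_centre.1 hX).1

theorem tmul_mem_weightSpace_zero {k : L} (hk : k ∈ 𝔨) :
    (1 : ℂ) ⊗ₜ[ℝ] k ∈ weightSpace (centre 𝔨) 0 := fun H => by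
  rw [lie_one_tmul, ← lie_skew, (mem_centre.1 H.2).2 k hk, neg_zero, TensorProduct.tmul_zero,
    Pi.zero_apply, zero_smul]

theorem lie_tmul_mem_weightSpace {ξ : centre 𝔨 → ℂ} {k : L} (hk : k ∈ 𝔨) {x : ℂ ⊗[ℝ] L}
    (hx : x ∈ weightSpace (centre 𝔨) ξ) : ⁅(1 : ℂ) ⊗ₜ[ℝ] k, x⁆ ∈ weightSpace (centre 𝔨) ξ :=
  lie_mem_weightSpace_of_add (tmul_mem_weightSpace_zero hk) hx (zero_add ξ)

section Centralizer

variable (hC : ∀ X : L, (∀ H ∈ centre 𝔨, ⁅X, H⁆ = 0) → X ∈ 𝔨)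
include hC

theorem mem_of_mem_weightSpace_zero {a b : L}
    (h : (1 : ℂ) ⊗ₜ[ℝ] a + Complex.I • ((1 : ℂ) ⊗ₜ[ℝ] b) ∈ weightSpace (centre 𝔨) 0) :
    a ∈ 𝔨 ∧ b ∈ 𝔨 := by
  have key : ∀ H ∈ centre 𝔨, ⁅H, a⁆ = 0 ∧ ⁅H, b⁆ = 0 := fun H hH => by
    have h1 := h ⟨H, hH⟩
    rw [Pi.zero_apply, zero_smul, lie_real_add_imaginary] at h1
    exact eq_zero_of_real_add_imaginary h1
  refine ⟨hC a fun H hH => ?_, hC b fun H hH => ?_⟩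
  · rw [← lie_skew, (key H hH).1, neg_zero]
  · rw [← lie_skew, (key H hH).2, neg_zero]

/-- The zero weight space of `𝔱` is `𝔨^ℂ`, as `𝔨` is the centralizer of its centre. -/
theorem weightSpace_zero :
    weightSpace (centre 𝔨) 0 = 𝔨.toSubmodule.baseChange ℂ := by
  apply le_antisymm
  · intro x hx
    obtain ⟨a, b, rfl⟩ := exists_real_add_imaginary x
    obtain ⟨ha, hb⟩ := mem_of_mem_weightSpace_zero hC hx
    exact add_mem (Submodule.tmul_mem_baseChange_of_mem _ ha)
      (Submodule.smul_mem _ _ (Submodule.tmul_mem_baseChange_of_mem _ hb))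
  · rw [Submodule.baseChange_eq_span, Submodule.span_le]
    rintro _ ⟨k, hk, rfl⟩
    exact tmul_mem_weightSpace_zero hk

end Centralizer

variable [FiniteDimensional ℝ L]

variable (hneg : ∀ X : L, X ≠ 0 → killingForm ℝ L X X < 0)
include hneg

/-- The Killing form is nondegenerate on the complexification of any real subspace. -/
theorem eq_zero_of_killingForm_eq_zero (𝔞 : Submodule ℝ L) {a b : L} (ha : a ∈ 𝔞) (hb : b ∈ 𝔞)
    (h : ∀ H ∈ 𝔞, killingForm ℂ (ℂ ⊗[ℝ] L) (1 ⊗ₜ H)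
      (1 ⊗ₜ a + Complex.I • ((1 : ℂ) ⊗ₜ[ℝ] b)) = 0) : a = 0 ∧ b = 0 := by
  have key : ∀ H ∈ 𝔞, killingForm ℝ L H a = 0 ∧ killingForm ℝ L H b = 0 := fun H hH => by
    have h1 := h H hH
    rw [map_add, map_smul, killingForm_tmul, killingForm_tmul] at h1
    constructor
    · simpa using congrArg Complex.re h1
    · simpa using congrArg Complex.im h1
  constructor
  · by_contra h0
    exact (hneg a h0).ne (key a ha).1
  · by_contra h0
    exact (hneg b h0).ne (key b hb).2

theorem exists_orthonormal_basis (V : Submodule ℂ (ℂ ⊗[ℝ] L)) :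
    ∃ (n : ℕ) (x : Fin n → ℂ ⊗[ℝ] L), (V ≠ ⊥ → 0 < n) ∧ (∀ i, x i ∈ V) ∧
      (∀ i, herm (x i) (x i) = 1) ∧ ∀ v ∈ V, v = ∑ i, herm (x i) v • x i := by
  let c := hermCore hneg
  let i1 : NormedAddCommGroup (ℂ ⊗[ℝ] L) := c.toNormedAddCommGroup
  let i2 : InnerProductSpace ℂ (ℂ ⊗[ℝ] L) := InnerProductSpace.ofCore c.toCore
  let b := stdOrthonormalBasis ℂ V
  refine ⟨Module.finrank ℂ V, fun i => b i, fun h => ?_, fun i => (b i).2, fun i => ?_,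
    fun v hv => ?_⟩
  · have := Submodule.nontrivial_iff_ne_bot.2 h
    exact Module.finrank_pos
  · have h := (orthonormal_iff_ite.1 b.orthonormal) i i
    rw [if_pos rfl] at h
    exact h
  · have h := b.sum_repr' ⟨v, hv⟩
    have h' := congrArg (fun w : V => (w : ℂ ⊗[ℝ] L)) h
    simp only [Submodule.coe_sum, Submodule.coe_smul] at h'
    exact h'.symm

/-- A weight of `𝔱` is represented, up to the factor `-i`, by a vector of `𝔱`. -/
theorem exists_dual_vector (𝔞 : Submodule ℝ L) (ξ : 𝔞 →ₗ[ℝ] ℂ)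
    (hξ : ∀ H, starRingEnd ℂ (ξ H) = -ξ H) :
    ∃ T ∈ 𝔞, ∀ H : 𝔞, ξ H = -Complex.I * (killingForm ℝ L T H : ℂ) := by
  let D : 𝔞 →ₗ[ℝ] Module.Dual ℝ 𝔞 :=
    (killingForm ℝ L).compl₁₂ 𝔞.subtype 𝔞.subtype
  have hinj : Function.Injective D := by
    rw [injective_iff_map_eq_zero]
    intro T hT
    by_contra h0
    refine (hneg (T : L) fun h => h0 (Subtype.ext h)).ne ?_
    exact congrArg (fun f => f T) hT
  have hsurj : Function.Surjective D :=
    (LinearMap.injective_iff_surjective_of_finrank_eq_finrank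
      (Subspace.dual_finrank_eq (K := ℝ) (V := 𝔞)).symm).1 hinj
  obtain ⟨T, hT⟩ := hsurj (-(Complex.imLm ∘ₗ ξ))
  refine ⟨T, T.2, fun H => ?_⟩
  have h1 : killingForm ℝ L T H = -(ξ H).im := congrArg (fun f => f H) hT
  have h2 := congrArg Complex.re (hξ H)
  rw [h1]
  apply Complex.ext
  · simp at h2 ⊢
    linarith
  · simp

end

/-! ### Irreducibility and nonvanishing brackets -/

section

variable {𝔨 : LieSubalgebra ℝ L}

/-- Stability of a complex subspace of `𝔤^ℂ` under `ad 𝔨`. -/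
def IsAdStable (𝔨 : LieSubalgebra ℝ L) (V : Submodule ℂ (ℂ ⊗[ℝ] L)) : Prop :=
  ∀ k ∈ 𝔨, ∀ x ∈ V, ⁅(1 : ℂ) ⊗ₜ[ℝ] k, x⁆ ∈ V

theorem isAdStable_weightSpace (ξ : centre 𝔨 → ℂ) : IsAdStable 𝔨 (weightSpace (centre 𝔨) ξ) :=
  fun _ hk _ hx => lie_tmul_mem_weightSpace hk hx

variable [FiniteDimensional ℝ L]

variable (hneg : ∀ X : L, X ≠ 0 → killingForm ℝ L X X < 0)
  (hC : ∀ X : L, (∀ H ∈ centre 𝔨, ⁅X, H⁆ = 0) → X ∈ 𝔨)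

omit [FiniteDimensional ℝ L] in
theorem herm_lie_tmul (k : L) (x y : ℂ ⊗[ℝ] L) :
    herm ⁅(1 : ℂ) ⊗ₜ[ℝ] k, x⁆ y = -herm x ⁅(1 : ℂ) ⊗ₜ[ℝ] k, y⁆ := by
  rw [herm_lie_left, conjugation_tmul, map_one]

/-- For an `ad 𝔨`-stable space with orthonormal basis `xᵢ`, the element `∑ [xᵢ, τ xᵢ]` commutes
with `𝔨`, because `ad 𝔨` acts by skew-hermitian operators. -/
theorem lie_sum_lie_conjugation_eq_zero {V : Submodule ℂ (ℂ ⊗[ℝ] L)} (hV : IsAdStable 𝔨 V) {n : ℕ}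
    {x : Fin n → ℂ ⊗[ℝ] L} (hxV : ∀ i, x i ∈ V)
    (hx : ∀ v ∈ V, v = ∑ i, herm (x i) v • x i) {k : L} (hk : k ∈ 𝔨) :
    ⁅(1 : ℂ) ⊗ₜ[ℝ] k, ∑ i, ⁅x i, τ (x i)⁆⁆ = 0 := by
  set u := (1 : ℂ) ⊗ₜ[ℝ] k with hu
  have hτ : τ u = u := by rw [hu, conjugation_tmul, map_one]
  set c : Fin n → Fin n → ℂ := fun j i => herm (x j) ⁅u, x i⁆ with hc
  have hux : ∀ i, ⁅u, x i⁆ = ∑ j, c j i • x j := fun i => hx _ (hV k hk _ (hxV i))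
  have hcc : ∀ i j, starRingEnd ℂ (c i j) = -c j i := fun i j => by
    simp only [hc]
    rw [herm_conj, hu, herm_lie_tmul]
  have h1 : ∀ i, ⁅u, ⁅x i, τ (x i)⁆⁆ =
      ∑ j, c j i • ⁅x j, τ (x i)⁆ + ∑ j, (-c i j) • ⁅x i, τ (x j)⁆ := fun i => by
    have h2 : ⁅u, τ (x i)⁆ = ∑ j, (-c i j) • τ (x j) := by
      have h3 := congrArg (conjugation L) (hux i)
      rw [conjugation_lie, hτ, map_sum] at h3
      rw [h3]
      exact Finset.sum_congr rfl fun j _ => by rw [conjugation_smul, hcc]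
    rw [cx_lie_lie, h2, hux, cx_sum_lie, cx_lie_sum]
    simp only [cx_smul_lie, cx_lie_smul]
  rw [cx_lie_sum, Finset.sum_congr rfl fun i _ => h1 i, Finset.sum_add_distrib,
    Finset.sum_comm (f := fun i j => (-c i j) • ⁅x i, τ (x j)⁆), ← Finset.sum_add_distrib]
  refine Finset.sum_eq_zero fun i _ => ?_
  rw [← Finset.sum_add_distrib]
  exact Finset.sum_eq_zero fun j _ => by rw [← add_smul, add_neg_cancel, zero_smul]

include hneg hC

/-- The trace argument on which everything rests: let `V` be a nonzero `ad 𝔨`-stable subspace of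
the weight space of `ξ`, and `y ≠ 0` a vector of weight `δ` with `[τ x, y] = 0` for all `x ∈ V`.
Then the vectors of `𝔱` representing `ξ` and `δ` satisfy `φ(T', T) ≥ 0`, that is `(δ, ξ) ≤ 0`.
Indeed `h = ∑ [xᵢ, τ xᵢ]` for an orthonormal basis of `V` is a multiple of the vector representing
`ξ`, and `⟨y, [h, y]⟩ = ∑ ‖[xᵢ, y]‖²`. -/
theorem killingForm_dual_nonneg {V : Submodule ℂ (ℂ ⊗[ℝ] L)} (hV : IsAdStable 𝔨 V) (hV0 : V ≠ ⊥)
    {ξ δ : centre 𝔨 → ℂ} (hVξ : V ≤ weightSpace (centre 𝔨) ξ) {T T' : L} (hT : T ∈ centre 𝔨)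
    (hξ : ∀ H, ξ H = -Complex.I * (killingForm ℝ L T H : ℂ))
    (hδ : ∀ H, δ H = -Complex.I * (killingForm ℝ L T' H : ℂ))
    {y : ℂ ⊗[ℝ] L} (hy : y ∈ weightSpace (centre 𝔨) δ) (hy0 : y ≠ 0)
    (hVy : ∀ x ∈ V, ⁅τ x, y⁆ = 0) : 0 ≤ killingForm ℝ L T' T := by
  obtain ⟨n, x, hn, hxV, hx1, hx⟩ := exists_orthonormal_basis hneg V
  have hn := hn hV0
  obtain ⟨h, hh⟩ : ∃ h, h = ∑ i, ⁅x i, τ (x i)⁆ := ⟨_, rfl⟩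
  have hh0 : h ∈ weightSpace (centre 𝔨) 0 := by
    rw [hh]
    exact Submodule.sum_mem _ fun i _ => lie_mem_weightSpace_of_add (hVξ (hxV i))
      (conjugation_mem_weightSpace hneg (hVξ (hxV i))) (add_neg_cancel ξ)
  have hKh : ∀ H ∈ centre 𝔨, killingForm ℂ (ℂ ⊗[ℝ] L) (1 ⊗ₜ H) h =
      n * (Complex.I * (killingForm ℝ L T H : ℂ)) := fun H hH => by
    have h1 : ∀ i, killingForm ℂ (ℂ ⊗[ℝ] L) (1 ⊗ₜ H) ⁅x i, τ (x i)⁆ =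
        Complex.I * (killingForm ℝ L T H : ℂ) := fun i => by
      have h2 := hx1 i
      rw [herm] at h2
      rw [← killingForm_lie, hVξ (hxV i) ⟨H, hH⟩, map_smul, LinearMap.smul_apply, killingForm_comm,
        hξ, smul_eq_mul]
      linear_combination (Complex.I * (killingForm ℝ L T H : ℂ)) * h2
    rw [hh, map_sum, Finset.sum_congr rfl fun i _ => h1 i, Finset.sum_const, Finset.card_univ,
      Fintype.card_fin, nsmul_eq_mul]
  -- `h` is the multiple `n i T` of the vector representing `ξ`.
  have hhT : h = (n * Complex.I) • ((1 : ℂ) ⊗ₜ[ℝ] T) := by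
    obtain ⟨a, b, hab⟩ := exists_real_add_imaginary h
    obtain ⟨ha, hb⟩ := mem_of_mem_weightSpace_zero hC (hab ▸ hh0)
    have hk : ∀ k ∈ 𝔨, ⁅k, a⁆ = 0 ∧ ⁅k, b⁆ = 0 := fun k hk =>
      eq_zero_of_real_add_imaginary (by
        rw [← lie_real_add_imaginary, ← hab, hh, lie_sum_lie_conjugation_eq_zero hV hxV hx hk])
    have hac : a ∈ centre 𝔨 := mem_centre.2 ⟨ha, fun k hk' => (hk k hk').1⟩
    have hbc : b ∈ centre 𝔨 := mem_centre.2 ⟨hb, fun k hk' => (hk k hk').2⟩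
    have hnT : (n * Complex.I) • ((1 : ℂ) ⊗ₜ[ℝ] T) = Complex.I • ((1 : ℂ) ⊗ₜ[ℝ] ((n : ℝ) • T)) := by
      rw [TensorProduct.tmul_smul, TensorProduct.smul_tmul', TensorProduct.smul_tmul',
        TensorProduct.smul_tmul', mul_comm, mul_smul]
      simp
    have hdiff : h - (n * Complex.I) • ((1 : ℂ) ⊗ₜ[ℝ] T) =
        1 ⊗ₜ a + Complex.I • ((1 : ℂ) ⊗ₜ[ℝ] (b - (n : ℝ) • T)) := by
      rw [hnT, hab, TensorProduct.tmul_sub, smul_sub]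
      abel
    obtain ⟨h1, h2⟩ := eq_zero_of_killingForm_eq_zero hneg (centre 𝔨) hac
      (sub_mem hbc ((centre 𝔨).smul_mem (n : ℝ) hT)) fun H hH => by
        rw [← hdiff, map_sub, hKh H hH, map_smul, killingForm_tmul,
          show killingForm ℝ L T H = killingForm ℝ L H T from LieModule.traceForm_comm ℝ _ _ _ _,
          smul_eq_mul]
        ring
    rw [h1, h2, TensorProduct.tmul_zero, smul_zero, add_zero] at hdiff
    exact sub_eq_zero.1 hdiff
  have hhy : ⁅h, y⁆ = ((n * killingForm ℝ L T' T : ℝ) : ℂ) • y := by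
    rw [hhT, cx_smul_lie, hy ⟨T, hT⟩, hδ, smul_smul]
    congr 1
    push_cast
    linear_combination (-(n : ℂ) * (killingForm ℝ L T' T : ℂ)) * Complex.I_mul_I
  have hsum : herm y ⁅h, y⁆ = ∑ i, herm ⁅x i, y⁆ ⁅x i, y⁆ := by
    -- The Jacobi identity, together with `[τ xᵢ, y] = 0`.
    have h1 : ⁅h, y⁆ = -∑ i, ⁅τ (x i), ⁅x i, y⁆⁆ := by
      rw [hh, cx_sum_lie, ← Finset.sum_neg_distrib]
      refine Finset.sum_congr rfl fun i _ => ?_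
      have h2 := cx_lie_lie (x i) (τ (x i)) y
      rw [hVy _ (hxV i), cx_lie_zero] at h2
      exact eq_neg_of_add_eq_zero_left h2.symm
    have h3 : ∀ (s : Finset (Fin n)) (f : Fin n → ℂ ⊗[ℝ] L),
        herm y (∑ i ∈ s, f i) = ∑ i ∈ s, herm y (f i) := fun s f => by
      simp only [herm, map_sum, Finset.sum_neg_distrib]
    rw [h1, ← Finset.sum_neg_distrib, h3]
    refine Finset.sum_congr rfl fun i _ => ?_
    rw [herm_lie_left, herm, herm, map_neg]
  rw [hhy, herm_smul_right] at hsum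
  have h1 := congrArg Complex.re hsum
  rw [Complex.re_ofReal_mul, Complex.re_sum] at h1
  have h2 : 0 ≤ ∑ i, (herm ⁅x i, y⁆ ⁅x i, y⁆).re :=
    Finset.sum_nonneg fun i _ => herm_self_re_nonneg hneg _
  have h3 : 0 < (herm y y).re := by
    refine lt_of_le_of_ne (herm_self_re_nonneg hneg y) fun h0 =>
      hy0 (eq_zero_of_herm_self hneg y ?_)
    obtain ⟨a, b, rfl⟩ := exists_real_add_imaginary y
    rw [herm_self, Complex.ofReal_re] at h0
    rw [herm_self, ← h0, Complex.ofReal_zero]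
  rw [← h1] at h2
  have h4 : (0 : ℝ) < n := Nat.cast_pos.2 hn
  by_contra! h5
  nlinarith [mul_pos h4 h3]

omit hC in
theorem exists_orthogonal_vector {U V : Submodule ℂ (ℂ ⊗[ℝ] L)} (hVU : V ≤ U) (h : ¬ U ≤ V) :
    ∃ y ∈ U, y ≠ 0 ∧ ∀ v ∈ V, herm v y = 0 := by
  let c := hermCore hneg
  let i1 : NormedAddCommGroup (ℂ ⊗[ℝ] L) := c.toNormedAddCommGroup
  let i2 : InnerProductSpace ℂ (ℂ ⊗[ℝ] L) := InnerProductSpace.ofCore c.toCore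
  obtain ⟨y, hyU, hyV⟩ := SetLike.not_le_iff_exists.1 h
  refine ⟨y - V.starProjection y, sub_mem hyU (hVU (V.starProjection_apply_mem y)), fun h0 => ?_,
    fun v hv => ?_⟩
  · rw [sub_eq_zero] at h0
    exact hyV (h0 ▸ V.starProjection_apply_mem y)
  · exact V.inner_right_of_mem_orthogonal hv (V.sub_starProjection_mem_orthogonal y)

/-- A weight space of `𝔱` with nonzero weight is an irreducible `ad 𝔨`-module. -/
theorem eq_weightSpace_of_isAdStable {V : Submodule ℂ (ℂ ⊗[ℝ] L)} (hV : IsAdStable 𝔨 V)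
    (hV0 : V ≠ ⊥) {ξ : centre 𝔨 →ₗ[ℝ] ℂ} (hξ0 : ξ ≠ 0) (hVξ : V ≤ weightSpace (centre 𝔨) ξ) :
    V = weightSpace (centre 𝔨) ξ := by
  refine le_antisymm hVξ ?_
  by_contra hlt
  obtain ⟨v, hv, hv0⟩ := V.ne_bot_iff.1 hV0
  obtain ⟨T, hT, hξT⟩ := exists_dual_vector hneg (centre 𝔨) ξ (weight_conj hneg (hVξ hv) hv0)
  obtain ⟨y, hyξ, hy0, hVy⟩ := exists_orthogonal_vector hneg hVξ hlt
  -- For `x ∈ V` the vector `[τ x, y]` lies in `𝔨^ℂ`, and it is orthogonal to `𝔨`.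
  have hVy' : ∀ x ∈ V, ⁅τ x, y⁆ = 0 := fun x hx => by
    have h0 : ⁅τ x, y⁆ ∈ weightSpace (centre 𝔨) 0 :=
      lie_mem_weightSpace_of_add (conjugation_mem_weightSpace hneg (hVξ hx)) hyξ
        (neg_add_cancel (ξ : centre 𝔨 → ℂ))
    have hK : ∀ k ∈ 𝔨, killingForm ℂ (ℂ ⊗[ℝ] L) (1 ⊗ₜ k) ⁅τ x, y⁆ = 0 := fun k hk => by
      have h1 := hVy _ (hV k hk x hx)
      rw [herm, conjugation_lie, conjugation_tmul, map_one, killingForm_lie, neg_eq_zero] at h1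
      exact h1
    obtain ⟨a, b, hab⟩ := exists_real_add_imaginary ⁅τ x, y⁆
    rw [hab] at h0 hK
    obtain ⟨ha, hb⟩ := mem_of_mem_weightSpace_zero hC h0
    obtain ⟨ha0, hb0⟩ := eq_zero_of_killingForm_eq_zero hneg 𝔨.toSubmodule ha hb hK
    rw [hab, ha0, hb0, TensorProduct.tmul_zero, smul_zero, add_zero]
  have h := killingForm_dual_nonneg hneg hC hV hV0 hVξ hT hξT hξT hyξ hy0 hVy'
  have hT0 : T = 0 := by
    by_contra hT0
    exact (hneg T hT0).not_ge h
  exact hξ0 (LinearMap.ext fun H => by rw [hξT, hT0]; simp)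

/-- The nonvanishing of `([𝔪_ξ, 𝔪_η], 𝔪_ζ)` in the case `(ξ + η, ξ) > 0`, where `D` represents
`ξ + η = -ζ`. -/
theorem exists_killingForm_lie_ne_zero_of_neg {ξ η ζ : centre 𝔨 →ₗ[ℝ] ℂ}
    (hξ : weightSpace (centre 𝔨) ξ ≠ ⊥) (hsum : ξ + η + ζ = 0) {T D : L} (hT : T ∈ centre 𝔨)
    (hξT : ∀ H : centre 𝔨, ξ H = -Complex.I * (killingForm ℝ L T H : ℂ))
    (hζD : ∀ H : centre 𝔨, (-ζ) H = -Complex.I * (killingForm ℝ L D H : ℂ))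
    (hneg' : killingForm ℝ L D T < 0) {w : ℂ ⊗[ℝ] L} (hw : w ∈ weightSpace (centre 𝔨) ζ)
    (hw0 : w ≠ 0) :
    ∃ x ∈ weightSpace (centre 𝔨) ξ, ∃ y ∈ weightSpace (centre 𝔨) η,
      killingForm ℂ (ℂ ⊗[ℝ] L) ⁅x, y⁆ w ≠ 0 := by
  have hτw : τ w ∈ weightSpace (centre 𝔨) (-ζ : centre 𝔨 →ₗ[ℝ] ℂ) :=
    conjugation_mem_weightSpace hneg hw
  have hτw0 : τ w ≠ 0 := fun h0 => hw0 (by rw [← conjugation_conjugation w, h0, map_zero])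
  obtain ⟨x, hx, hxw⟩ : ∃ x ∈ weightSpace (centre 𝔨) ξ, ⁅τ x, τ w⁆ ≠ 0 := by
    by_contra! h
    exact hneg'.not_ge (killingForm_dual_nonneg hneg hC (isAdStable_weightSpace _) hξ le_rfl hT
      hξT hζD hτw hτw0 h)
  have hη : -(ξ : centre 𝔨 → ℂ) + ⇑(-ζ) = η := by
    rw [show η = -ξ + -ζ by rw [← sub_eq_zero, ← hsum]; abel]
    rfl
  refine ⟨x, hx, ⁅τ x, τ w⁆, lie_mem_weightSpace_of_add (conjugation_mem_weightSpace hneg hx) hτw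
    hη, fun h0 => hxw (eq_zero_of_herm_self hneg _ ?_)⟩
  rw [← cx_lie_skew, map_neg, LinearMap.neg_apply, killingForm_lie, neg_eq_zero] at h0
  rw [herm, conjugation_lie, conjugation_conjugation, conjugation_conjugation, killingForm_comm,
    h0, neg_zero]

/-- If three weights of `𝔱` have sum zero, the bracket of the weight spaces of two of them pairs
nontrivially with the third: one of the two has positive inner product with their sum, and for it
`killingForm_dual_nonneg` applies. -/
theorem exists_killingForm_lie_ne_zero {ξ η ζ : centre 𝔨 →ₗ[ℝ] ℂ}
    (hξ : weightSpace (centre 𝔨) ξ ≠ ⊥) (hη : weightSpace (centre 𝔨) η ≠ ⊥)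
    (hζ : weightSpace (centre 𝔨) ζ ≠ ⊥) (hζ0 : ζ ≠ 0) (hsum : ξ + η + ζ = 0) :
    ∃ x ∈ weightSpace (centre 𝔨) ξ, ∃ y ∈ weightSpace (centre 𝔨) η,
      ∃ z ∈ weightSpace (centre 𝔨) ζ, killingForm ℂ (ℂ ⊗[ℝ] L) ⁅x, y⁆ z ≠ 0 := by
  have dual : ∀ {ξ : centre 𝔨 →ₗ[ℝ] ℂ}, weightSpace (centre 𝔨) ξ ≠ ⊥ → ∃ T ∈ centre 𝔨,
      ∀ H : centre 𝔨, ξ H = -Complex.I * (killingForm ℝ L T H : ℂ) := fun {ξ} hξ => by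
    obtain ⟨v, hv, hv0⟩ := (Submodule.ne_bot_iff _).1 hξ
    exact exists_dual_vector hneg (centre 𝔨) ξ (weight_conj hneg hv hv0)
  obtain ⟨T, hT, hξT⟩ := dual hξ
  obtain ⟨T', hT', hηT⟩ := dual hη
  have hδ : ∀ H : centre 𝔨, (-ζ) H = -Complex.I * (killingForm ℝ L (T + T') H : ℂ) := fun H => by
    rw [← eq_neg_of_add_eq_zero_left hsum, LinearMap.add_apply, hξT, hηT, map_add,
      LinearMap.add_apply]
    push_cast
    ring
  have hT0 : T + T' ≠ 0 := fun h0 => hζ0 (LinearMap.ext fun H => by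
    have h1 := hδ H
    rw [h0, map_zero, LinearMap.zero_apply, Complex.ofReal_zero, mul_zero, LinearMap.neg_apply,
      neg_eq_zero] at h1
    exact h1)
  obtain ⟨w, hw, hw0⟩ := (Submodule.ne_bot_iff _).1 hζ
  have h1 := hneg _ hT0
  rw [map_add (killingForm ℝ L (T + T'))] at h1
  rcases lt_or_ge (killingForm ℝ L (T + T') T) 0 with h2 | h2
  · obtain ⟨x, hx, y, hy, h⟩ := exists_killingForm_lie_ne_zero_of_neg hneg hC hξ hsum hT hξT hδ h2
      hw hw0
    exact ⟨x, hx, y, hy, w, hw, h⟩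
  · obtain ⟨y, hy, x, hx, h⟩ := exists_killingForm_lie_ne_zero_of_neg hneg hC hη
      ((congrArg (· + ζ) (add_comm η ξ)).trans hsum) hT' hηT hδ (by linarith) hw hw0
    refine ⟨x, hx, y, hy, w, hw, fun h0 => h ?_⟩
    rw [← cx_lie_skew, map_neg, LinearMap.neg_apply, h0, neg_zero]

end

/-! ### Roots and invariant orderings -/

section

variable {𝔨 : LieSubalgebra ℝ L} (A : MaximalAbelianIn 𝔨)

/-- The weight of `𝔥` given by restricting a linear form on `𝔥^ℂ`. -/
def realWeight (α : Module.Dual ℂ A.complexified) (H : A.𝔥.toSubmodule) : ℂ :=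
  α ⟨1 ⊗ₜ (H : L), Submodule.tmul_mem_baseChange_of_mem 1 H.2⟩

/-- The root spaces, defined by `𝔥^ℂ`, are simultaneous eigenspaces of the real subalgebra `𝔥`. -/
theorem rootSpace_eq (α : Module.Dual ℂ A.complexified) :
    rootSpace A α = weightSpace A.𝔥.toSubmodule (realWeight A α) := by
  ext x
  simp only [rootSpace, Submodule.mem_iInf, Module.End.mem_eigenspace_iff]
  constructor
  · exact fun h H => h ⟨1 ⊗ₜ (H : L), Submodule.tmul_mem_baseChange_of_mem 1 H.2⟩
  · rintro h ⟨u, hu⟩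
    have hu' := hu
    rw [MaximalAbelianIn.complexified, Submodule.baseChange_eq_span] at hu'
    change ⁅u, x⁆ = _
    induction hu' using Submodule.span_induction with
    | mem u hu' =>
      obtain ⟨H, hH, rfl⟩ := hu'
      exact h ⟨H, hH⟩
    | zero => rw [cx_zero_lie, show (⟨0, hu⟩ : A.complexified) = 0 from rfl, map_zero, zero_smul]
    | add u v hu' hv' ihu ihv =>
      have hu := hu'
      have hv := hv'
      rw [← Submodule.baseChange_eq_span] at hu hv
      rw [cx_add_lie, ihu hu, ihv hv, ← add_smul, ← map_add]
      rfl
    | smul c u hu' ihu =>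
      have hu := hu'
      rw [← Submodule.baseChange_eq_span] at hu
      rw [cx_smul_lie, ihu hu, smul_smul, ← smul_eq_mul, ← map_smul]
      rfl

theorem realWeight_injective : Function.Injective (realWeight A) := by
  intro α β h
  ext ⟨u, hu⟩
  have hu' := hu
  rw [MaximalAbelianIn.complexified, Submodule.baseChange_eq_span] at hu'
  induction hu' using Submodule.span_induction with
  | mem u hu' =>
    obtain ⟨H, hH, rfl⟩ := hu'
    exact congrFun h ⟨H, hH⟩
  | zero => rw [show (⟨0, hu⟩ : A.complexified) = 0 from rfl, map_zero, map_zero]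
  | add u v hu' hv' ihu ihv =>
    have hu := hu'
    have hv := hv'
    rw [← Submodule.baseChange_eq_span] at hu hv
    have h1 := congrArg₂ (· + ·) (ihu hu) (ihv hv)
    simp only [← map_add] at h1
    exact h1
  | smul c u hu' ihu =>
    have hu := hu'
    rw [← Submodule.baseChange_eq_span] at hu
    have h1 := congrArg (c • ·) (ihu hu)
    simp only [← map_smul] at h1
    exact h1

theorem rootSpace_le_weightSpace (α : Module.Dual ℂ A.complexified) :
    rootSpace A α ≤ weightSpace (centre 𝔨) (kappa A α) := by
  rw [rootSpace_eq]
  exact fun x hx H => hx ⟨H, centre_le A H.2⟩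

theorem kappa_add (α β : Module.Dual ℂ A.complexified) :
    kappa A (α + β) = kappa A α + kappa A β := rfl

variable {A} {α β : Module.Dual ℂ A.complexified} {x y : ℂ ⊗[ℝ] L}

theorem lie_mem_rootSpace (hx : x ∈ rootSpace A α) (hy : y ∈ rootSpace A β) :
    ⁅x, y⁆ ∈ rootSpace A (α + β) := by
  rw [rootSpace_eq] at *
  exact lie_mem_weightSpace_of_add hx hy rfl

variable (A) in
/-- A simultaneous eigenvector of `𝔥` is an eigenvector of `𝔥^ℂ`. -/
theorem exists_weightSpace_eq_rootSpace {ξ : A.𝔥.toSubmodule → ℂ}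
    (hx : x ∈ weightSpace A.𝔥.toSubmodule ξ) (hx0 : x ≠ 0) : ∃ α, x ∈ rootSpace A α := by
  have key : ∀ u : A.complexified, ∃ c : ℂ, ⁅(u : ℂ ⊗[ℝ] L), x⁆ = c • x := by
    rintro ⟨u, hu⟩
    change ∃ c : ℂ, ⁅u, x⁆ = c • x
    rw [MaximalAbelianIn.complexified, Submodule.baseChange_eq_span] at hu
    induction hu using Submodule.span_induction with
    | mem u hu =>
      obtain ⟨H, hH, rfl⟩ := hu
      exact ⟨_, hx ⟨H, hH⟩⟩
    | zero => exact ⟨0, by rw [cx_zero_lie, zero_smul]⟩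
    | add u v _ _ ihu ihv =>
      obtain ⟨c, hc⟩ := ihu
      obtain ⟨d, hd⟩ := ihv
      exact ⟨c + d, by rw [cx_add_lie, hc, hd, add_smul]⟩
    | smul r u _ ihu =>
      obtain ⟨c, hc⟩ := ihu
      exact ⟨r * c, by rw [cx_smul_lie, hc, smul_smul]⟩
  choose c hc using key
  have hinj : ∀ a b : ℂ, a • x = b • x → a = b := fun a b h => smul_left_injective ℂ hx0 h
  refine ⟨⟨⟨c, fun u v => hinj _ _ ?_⟩, fun r u => hinj _ _ ?_⟩, ?_⟩
  · rw [← hc, add_smul, ← hc, ← hc, Submodule.coe_add, cx_add_lie]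
  · rw [← hc, smul_assoc, RingHom.id_apply, ← hc, Submodule.coe_smul, cx_smul_lie]
  · simp only [rootSpace, Submodule.mem_iInf, Module.End.mem_eigenspace_iff]
    exact hc

variable [FiniteDimensional ℝ L] (hneg : ∀ X : L, X ≠ 0 → killingForm ℝ L X X < 0)

include hneg

theorem herm_eq_zero_of_root_ne (hx : x ∈ rootSpace A α) (hy : y ∈ rootSpace A β) (h : α ≠ β) :
    herm x y = 0 := by
  rw [rootSpace_eq] at hx hy
  exact herm_eq_zero_of_weight_ne hneg hx hy ((realWeight_injective A).ne h)

theorem conjugation_mem_rootSpace (hx : x ∈ rootSpace A α) : τ x ∈ rootSpace A (-α) := by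
  rw [rootSpace_eq] at *
  exact conjugation_mem_weightSpace hneg hx

variable (A) in
/-- A subspace of `𝔤^ℂ` stable under `𝔥` is the sum of its intersections with the root spaces
(among them the one of the linear form `0`). -/
theorem le_iSup_inf_rootSpace {V : Submodule ℂ (ℂ ⊗[ℝ] L)} (hV : IsAdStable 𝔨 V) :
    V ≤ ⨆ α, V ⊓ rootSpace A α := by
  refine (le_iSup_inf_weightSpace hneg (𝔞 := A.𝔥.toSubmodule) A.abelian V
    fun H x hx => hV H (A.le H.2) x hx).trans (iSup_le fun ξ => ?_)
  rintro x ⟨hxV, hx⟩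
  rcases eq_or_ne x 0 with rfl | hx0
  · exact Submodule.zero_mem _
  obtain ⟨α, hα⟩ := exists_weightSpace_eq_rootSpace A hx hx0
  exact Submodule.mem_iSup_of_mem α ⟨hxV, hα⟩

theorem weight_eq_of_mem {𝔞 : Submodule ℝ L} {ξ η : 𝔞 →ₗ[ℝ] ℂ} (h1 : x ∈ weightSpace 𝔞 ξ)
    (h2 : x ∈ weightSpace 𝔞 η) (hx0 : x ≠ 0) : ξ = η := by
  by_contra h
  exact hx0 (eq_zero_of_herm_self hneg x
    (herm_eq_zero_of_weight_ne hneg h1 h2 fun h' => h (DFunLike.coe_injective h')))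

theorem weightSpace_ne_bot_neg {𝔞 : Submodule ℝ L} {ξ : 𝔞 →ₗ[ℝ] ℂ} (h : weightSpace 𝔞 ξ ≠ ⊥) :
    weightSpace 𝔞 (-ξ : 𝔞 →ₗ[ℝ] ℂ) ≠ ⊥ := by
  obtain ⟨v, hv, hv0⟩ := (Submodule.ne_bot_iff _).1 h
  exact (Submodule.ne_bot_iff _).2 ⟨τ v, conjugation_mem_weightSpace hneg hv, fun h0 =>
    hv0 (by rw [← conjugation_conjugation v, h0, map_zero])⟩

variable (hC : ∀ X : L, (∀ H ∈ centre 𝔨, ⁅X, H⁆ = 0) → X ∈ 𝔨)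
include hC

/-- The roots of `𝔨^ℂ` are the roots that vanish on the centre of `𝔨`. -/
theorem mem_isotropyRoots_iff : α ∈ isotropyRoots A ↔ α ∈ roots A ∧ kappa A α = 0 := by
  refine and_congr_right fun hα => ?_
  rw [← weightSpace_zero hC]
  constructor
  · intro h
    obtain ⟨v, hv, hv0⟩ := (Submodule.ne_bot_iff _).1 hα.2
    exact weight_eq_of_mem hneg (rootSpace_le_weightSpace A α hv) (h hv) hv0
  · intro h
    have h1 := rootSpace_le_weightSpace A α
    rwa [h] at h1

theorem mem_complementaryRoots_iff :
    α ∈ complementaryRoots A ↔ rootSpace A α ≠ ⊥ ∧ kappa A α ≠ 0 := by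
  rw [complementaryRoots, Set.mem_sdiff, mem_isotropyRoots_iff hneg hC]
  constructor
  · exact fun h => ⟨h.1.2, fun h' => h.2 ⟨h.1, h'⟩⟩
  · refine fun h => ⟨⟨?_, h.1⟩, fun h' => h.2 h'.2⟩
    rintro rfl
    exact h.2 rfl

theorem tRootModule_eq {ξ : centre 𝔨 →ₗ[ℝ] ℂ} (hξ : ξ ≠ 0) :
    tRootModule A ξ = weightSpace (centre 𝔨) ξ := by
  apply le_antisymm
  · refine iSup₂_le fun α hα => ?_
    rw [← hα.2]
    exact rootSpace_le_weightSpace A α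
  · refine (le_iSup_inf_rootSpace A hneg (isAdStable_weightSpace _)).trans (iSup_le fun α => ?_)
    rintro x ⟨hxξ, hxα⟩
    rcases eq_or_ne x 0 with rfl | hx0
    · exact Submodule.zero_mem _
    have h := weight_eq_of_mem hneg (rootSpace_le_weightSpace A α hxα) hxξ hx0
    exact Submodule.mem_iSup_of_mem α (Submodule.mem_iSup_of_mem
      ⟨(mem_complementaryRoots_iff hneg hC).2
        ⟨(Submodule.ne_bot_iff _).2 ⟨x, hxα, hx0⟩, h ▸ hξ⟩, h⟩ hxα)

/-- The `𝔱`-roots are the nonzero weights of `𝔱` on `𝔤^ℂ`. -/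
theorem mem_tRoots_iff {ξ : centre 𝔨 →ₗ[ℝ] ℂ} :
    ξ ∈ tRoots A ↔ ξ ≠ 0 ∧ weightSpace (centre 𝔨) ξ ≠ ⊥ := by
  constructor
  · rintro ⟨α, hα, rfl⟩
    obtain ⟨h1, h2⟩ := (mem_complementaryRoots_iff hneg hC).1 hα
    exact ⟨h2, ne_bot_of_le_ne_bot h1 (rootSpace_le_weightSpace A α)⟩
  · rintro ⟨h1, h2⟩
    rw [← tRootModule_eq (A := A) hneg hC h1] at h2
    by_contra h
    refine h2 (eq_bot_iff.2 (iSup₂_le fun α hα => ?_))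
    exact (h ⟨α, hα.1, hα.2⟩).elim

theorem neg_mem_tRoots {ξ : centre 𝔨 →ₗ[ℝ] ℂ} (hξ : ξ ∈ tRoots A) : -ξ ∈ tRoots A := by
  rw [mem_tRoots_iff hneg hC] at *
  exact ⟨neg_ne_zero.2 hξ.1, weightSpace_ne_bot_neg hneg hξ.2⟩

section Ordering

variable {P : Set (Module.Dual ℂ A.complexified)} (hP : IsInvariantOrdering A P)
include hP

/-- The sum of the root spaces with root in an invariant ordering and given restriction to `𝔱` is
`ad 𝔨`-stable. -/
theorem isAdStable_iSup_rootSpace (ξ : centre 𝔨 →ₗ[ℝ] ℂ) :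
    IsAdStable 𝔨 (⨆ α : {α // α ∈ P ∧ kappa A α = ξ}, rootSpace A α) := by
  intro k hk v hv
  have hPc : P ⊆ complementaryRoots A := hP.union_neg ▸ Set.subset_union_left
  have hu := le_iSup_inf_rootSpace A hneg (isAdStable_weightSpace _) (tmul_mem_weightSpace_zero hk)
  generalize (1 : ℂ) ⊗ₜ[ℝ] k = u at hu
  induction hu using Submodule.iSup_induction' with
  | zero => rw [cx_zero_lie]; exact Submodule.zero_mem _
  | add u u' _ _ h h' => rw [cx_add_lie]; exact add_mem h h'
  | mem β u hu =>
    induction hv using Submodule.iSup_induction' with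
    | zero => rw [cx_lie_zero]; exact Submodule.zero_mem _
    | add v v' _ _ h h' => rw [cx_lie_add]; exact add_mem h h'
    | mem α v hv =>
      obtain ⟨α, hαP, hαξ⟩ := α
      have huv := lie_mem_rootSpace hv hu.2
      rw [← cx_lie_skew]
      refine neg_mem ?_
      by_cases h0 : ⁅v, u⁆ = 0
      · rw [h0]; exact Submodule.zero_mem _
      have hu0 : u ≠ 0 := by
        rintro rfl
        exact h0 (cx_lie_zero v)
      have hκβ : kappa A β = 0 :=
        weight_eq_of_mem hneg (rootSpace_le_weightSpace A β hu.2) hu.1 hu0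
      have hκ : kappa A (α + β) = ξ := by rw [kappa_add, hκβ, hαξ, add_zero]
      have hαβ : α + β ∈ P := by
        by_cases hβ : β = 0
        · rwa [hβ, add_zero]
        refine hP.add_isotropy_mem α hαP β ((mem_isotropyRoots_iff hneg hC).2
          ⟨⟨hβ, (Submodule.ne_bot_iff _).2 ⟨u, hu.2, hu0⟩⟩, hκβ⟩) ?_
        refine ((mem_complementaryRoots_iff hneg hC).2
          ⟨(Submodule.ne_bot_iff _).2 ⟨_, huv, h0⟩, ?_⟩).1
        rw [hκ, ← hαξ]
        exact ((mem_complementaryRoots_iff hneg hC).1 (hPc hαP)).2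
      exact Submodule.mem_iSup_of_mem (⟨α + β, hαβ, hκ⟩ : {α // α ∈ P ∧ kappa A α = ξ}) huv

/-- An invariant ordering contains, with a root, all roots with the same restriction to `𝔱`. -/
theorem mem_ordering_of_kappa_eq (hα : α ∈ P) (hβ : β ∈ complementaryRoots A)
    (h : kappa A β = kappa A α) : β ∈ P := by
  have hPc : P ⊆ complementaryRoots A := hP.union_neg ▸ Set.subset_union_left
  obtain ⟨hα1, hα2⟩ := (mem_complementaryRoots_iff hneg hC).1 (hPc hα)
  have hV := eq_weightSpace_of_isAdStable hneg hC
    (isAdStable_iSup_rootSpace hneg hC hP (kappa A α))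
    (ne_bot_of_le_ne_bot hα1 (le_iSup (fun α : {β // β ∈ P ∧ kappa A β = kappa A α} =>
      rootSpace A α) ⟨α, hα, rfl⟩)) hα2
    (iSup_le fun β => (rootSpace_le_weightSpace A β).trans_eq (by rw [β.2.2]))
  by_contra hβP
  obtain ⟨y, hy, hy0⟩ := (Submodule.ne_bot_iff _).1 ((mem_complementaryRoots_iff hneg hC).1 hβ).1
  have hyV : y ∈ weightSpace (centre 𝔨) (kappa A α) := h ▸ rootSpace_le_weightSpace A β hy
  rw [← hV] at hyV
  refine hy0 (eq_zero_of_herm_self hneg y ?_)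
  have key : ∀ v ∈ ⨆ α' : {β // β ∈ P ∧ kappa A β = kappa A α}, rootSpace A α',
      herm y v = 0 := by
    intro v hv
    induction hv using Submodule.iSup_induction' with
    | zero => simp [herm]
    | add v v' _ _ h h' => rw [herm_add_right, h, h', add_zero]
    | mem γ v hv =>
      exact herm_eq_zero_of_root_ne hneg hy hv fun h' => hβP (h' ▸ γ.2.1)
  exact key y hyV

/-- Three `𝔱`-roots with sum zero are not all positive: otherwise there would be root vectors of
positive roots `α`, `β`, `γ` with `([x, y], z) ≠ 0`, so that `α + β = -γ` would be both positive and
negative. -/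
theorem not_all_mem_ordering {ξ η ζ : centre 𝔨 →ₗ[ℝ] ℂ} (hξ : ξ ∈ kappa A '' P)
    (hη : η ∈ kappa A '' P) (hζ : ζ ∈ kappa A '' P) (hsum : ξ + η + ζ = 0) : False := by
  have hPc : P ⊆ complementaryRoots A := hP.union_neg ▸ Set.subset_union_left
  have ht : ∀ {ξ}, ξ ∈ kappa A '' P → ξ ≠ 0 ∧ weightSpace (centre 𝔨) ξ ≠ ⊥ := fun h =>
    (mem_tRoots_iff (A := A) hneg hC).1 (Set.image_mono hPc h)
  have hmem : ∀ {ξ α} {x : ℂ ⊗[ℝ] L}, ξ ∈ kappa A '' P →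
      x ∈ weightSpace (centre 𝔨) ξ ⊓ rootSpace A α → x ≠ 0 → α ∈ P := by
    rintro _ α x ⟨β, hβ, rfl⟩ ⟨hx, hxα⟩ hx0
    have h := weight_eq_of_mem hneg (rootSpace_le_weightSpace A α hxα) hx hx0
    refine mem_ordering_of_kappa_eq hneg hC hP hβ ((mem_complementaryRoots_iff hneg hC).2
      ⟨(Submodule.ne_bot_iff _).2 ⟨x, hxα, hx0⟩, ?_⟩) h
    rw [h]
    exact ((mem_complementaryRoots_iff hneg hC).1 (hPc hβ)).2
  obtain ⟨x, hx, y, hy, z, hz, hxyz⟩ := exists_killingForm_lie_ne_zero hneg hC (ht hξ).2 (ht hη).2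
    (ht hζ).2 (ht hζ).1 hsum
  refine hxyz ?_
  replace hx := le_iSup_inf_rootSpace A hneg (isAdStable_weightSpace _) hx
  replace hy := le_iSup_inf_rootSpace A hneg (isAdStable_weightSpace _) hy
  replace hz := le_iSup_inf_rootSpace A hneg (isAdStable_weightSpace _) hz
  clear hxyz
  induction hx using Submodule.iSup_induction' with
  | zero => rw [cx_zero_lie, map_zero, LinearMap.zero_apply]
  | add x x' _ _ h h' => rw [cx_add_lie, map_add, LinearMap.add_apply, h, h', add_zero]
  | mem α x hx =>
  induction hy using Submodule.iSup_induction' with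
  | zero => rw [cx_lie_zero, map_zero, LinearMap.zero_apply]
  | add y y' _ _ h h' => rw [cx_lie_add, map_add, LinearMap.add_apply, h, h', add_zero]
  | mem β y hy =>
  induction hz using Submodule.iSup_induction' with
  | zero => rw [map_zero]
  | add z z' _ _ h h' => rw [map_add, h, h', add_zero]
  | mem γ z hz =>
  by_contra h0
  have hx0 : x ≠ 0 := by
    rintro rfl
    exact h0 (by rw [cx_zero_lie, map_zero, LinearMap.zero_apply])
  have hy0 : y ≠ 0 := by
    rintro rfl
    exact h0 (by rw [cx_lie_zero, map_zero, LinearMap.zero_apply])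
  have hz0 : z ≠ 0 := by
    rintro rfl
    exact h0 (by rw [map_zero])
  have hα := hmem hξ hx hx0
  have hβ := hmem hη hy hy0
  have hγ := hmem hζ hz hz0
  have hαβγ : -(α + β) = γ := by
    by_contra hne
    have h1 := herm_eq_zero_of_root_ne hneg
      (conjugation_mem_rootSpace hneg (lie_mem_rootSpace hx.2 hy.2)) hz.2 hne
    rw [herm, conjugation_conjugation, neg_eq_zero] at h1
    exact h0 h1
  have hγ' : α + β ∈ -P := by
    rw [Set.mem_neg, hαβγ]
    exact hγ
  exact Set.disjoint_left.1 hP.disjoint_neg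
    (hP.add_mem α hα β hβ (hP.union_neg ▸ Set.mem_union_right _ hγ')) hγ'

end Ordering

end

/-! ### Real submodules and corresponding `𝔱`-roots -/

section

variable {𝔨 : LieSubalgebra ℝ L} {A : MaximalAbelianIn 𝔨}

theorem exists_of_mem_baseChange {N : Submodule ℝ L} {x : ℂ ⊗[ℝ] L} (hx : x ∈ N.baseChange ℂ) :
    ∃ a ∈ N, ∃ b ∈ N, x = 1 ⊗ₜ a + Complex.I • ((1 : ℂ) ⊗ₜ[ℝ] b) := by
  rw [Submodule.baseChange_eq_span] at hx
  induction hx using Submodule.span_induction with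
  | mem x hx =>
    obtain ⟨a, ha, rfl⟩ := hx
    exact ⟨a, ha, 0, N.zero_mem, by rw [TensorProduct.tmul_zero, smul_zero, add_zero]; rfl⟩
  | zero => exact ⟨0, N.zero_mem, 0, N.zero_mem, by simp⟩
  | add x y _ _ hx hy =>
    obtain ⟨a, ha, b, hb, rfl⟩ := hx
    obtain ⟨a', ha', b', hb', rfl⟩ := hy
    refine ⟨a + a', add_mem ha ha', b + b', add_mem hb hb', ?_⟩
    rw [TensorProduct.tmul_add, TensorProduct.tmul_add, smul_add]
    abel
  | smul c x _ hx =>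
    obtain ⟨a, ha, b, hb, rfl⟩ := hx
    refine ⟨c.re • a - c.im • b, sub_mem (N.smul_mem _ ha) (N.smul_mem _ hb),
      c.im • a + c.re • b, add_mem (N.smul_mem _ ha) (N.smul_mem _ hb), ?_⟩
    have h : ∀ (r : ℝ) (v : L), (1 : ℂ) ⊗ₜ[ℝ] (r • v) = (r : ℂ) • ((1 : ℂ) ⊗ₜ[ℝ] v) := fun r v => by
      rw [TensorProduct.tmul_smul, TensorProduct.smul_tmul', TensorProduct.smul_tmul',
        Complex.real_smul, smul_eq_mul]
    rw [TensorProduct.tmul_sub, TensorProduct.tmul_add, h, h, h, h]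
    have hI : c * Complex.I = -c.im + c.re * Complex.I := by
      linear_combination Complex.I * (Complex.re_add_im c).symm + (c.im : ℂ) * Complex.I_mul_I
    rw [smul_add, smul_smul, hI]
    nth_rewrite 1 [← Complex.re_add_im c]
    module

theorem tmul_mem_baseChange_iff {N : Submodule ℝ L} {a : L} :
    (1 : ℂ) ⊗ₜ[ℝ] a ∈ N.baseChange ℂ ↔ a ∈ N := by
  refine ⟨fun h => ?_, fun h => Submodule.tmul_mem_baseChange_of_mem _ h⟩
  obtain ⟨a', ha', b, -, h⟩ := exists_of_mem_baseChange h
  have h1 : (1 : ℂ) ⊗ₜ[ℝ] (a - a') + Complex.I • ((1 : ℂ) ⊗ₜ[ℝ] (-b)) = 0 := by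
    rw [TensorProduct.tmul_sub, TensorProduct.tmul_neg, h, smul_neg]
    abel
  rwa [sub_eq_zero.1 (eq_zero_of_real_add_imaginary h1).1]

theorem realPoints_baseChange (N : Submodule ℝ L) : realPoints (N.baseChange ℂ) = N :=
  Submodule.ext fun _ => tmul_mem_baseChange_iff

theorem conjugation_mem_baseChange {N : Submodule ℝ L} {x : ℂ ⊗[ℝ] L} (hx : x ∈ N.baseChange ℂ) :
    τ x ∈ N.baseChange ℂ := by
  obtain ⟨a, ha, b, hb, rfl⟩ := exists_of_mem_baseChange hx
  rw [map_add, conjugation_smul, conjugation_tmul, conjugation_tmul, map_one]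
  exact add_mem (Submodule.tmul_mem_baseChange_of_mem _ ha)
    (Submodule.smul_mem _ _ (Submodule.tmul_mem_baseChange_of_mem _ hb))

/-- A complex subspace of `𝔤^ℂ` stable under conjugation is the complexification of its real
points. -/
theorem baseChange_realPoints {U : Submodule ℂ (ℂ ⊗[ℝ] L)} (hU : ∀ x ∈ U, τ x ∈ U) :
    (realPoints U).baseChange ℂ = U := by
  apply le_antisymm
  · rw [Submodule.baseChange_eq_span, Submodule.span_le]
    rintro _ ⟨a, ha, rfl⟩
    exact ha
  · intro x hx
    obtain ⟨a, b, rfl⟩ := exists_real_add_imaginary x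
    have h := hU _ hx
    rw [map_add, conjugation_smul, conjugation_tmul, conjugation_tmul, map_one,
      Complex.conj_I, neg_smul] at h
    have ha : (1 : ℂ) ⊗ₜ[ℝ] a ∈ U := by
      have h1 := U.smul_mem (2⁻¹ : ℂ) (add_mem hx h)
      rwa [add_add_add_comm, add_neg_cancel, add_zero, ← two_smul ℂ, smul_smul,
        inv_mul_cancel₀ two_ne_zero, one_smul] at h1
    have hb : Complex.I • ((1 : ℂ) ⊗ₜ[ℝ] b) ∈ U := by
      have h1 := sub_mem hx ha
      rwa [add_sub_cancel_left] at h1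
    have hb' : (1 : ℂ) ⊗ₜ[ℝ] b ∈ U := (U.smul_mem_iff Complex.I_ne_zero).1 hb
    exact add_mem (Submodule.tmul_mem_baseChange_of_mem _ ha)
      (Submodule.smul_mem _ _ (Submodule.tmul_mem_baseChange_of_mem _ hb'))

/-- The real points of an `ad 𝔨`-stable complex subspace, as an `ad 𝔨`-module. -/
def realSubmodule {U : Submodule ℂ (ℂ ⊗[ℝ] L)} (hU : IsAdStable 𝔨 U) : LieSubmodule ℝ 𝔨 L where
  toSubmodule := realPoints U
  lie_mem {k x} hx := by
    change (1 : ℂ) ⊗ₜ[ℝ] ⁅(k : L), x⁆ ∈ U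
    rw [← lie_one_tmul]
    exact hU k k.2 _ hx

theorem isAdStable_baseChange (𝔫 : LieSubmodule ℝ 𝔨 L) :
    IsAdStable 𝔨 (𝔫.toSubmodule.baseChange ℂ) := by
  intro k hk x hx
  obtain ⟨a, ha, b, hb, rfl⟩ := exists_of_mem_baseChange hx
  rw [lie_real_add_imaginary]
  exact add_mem (Submodule.tmul_mem_baseChange_of_mem _ (𝔫.lie_mem (x := ⟨k, hk⟩) ha))
    (Submodule.smul_mem _ _ (Submodule.tmul_mem_baseChange_of_mem _
      (𝔫.lie_mem (x := ⟨k, hk⟩) hb)))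

theorem IsAdStable.sup {U V : Submodule ℂ (ℂ ⊗[ℝ] L)} (hU : IsAdStable 𝔨 U)
    (hV : IsAdStable 𝔨 V) : IsAdStable 𝔨 (U ⊔ V) := by
  intro k hk x hx
  obtain ⟨u, hu, v, hv, rfl⟩ := Submodule.mem_sup.1 hx
  rw [cx_lie_add]
  exact Submodule.add_mem_sup (hU k hk u hu) (hV k hk v hv)

theorem eq_of_le_of_isIrreducible {𝔫 R : LieSubmodule ℝ 𝔨 L} (h𝔫 : LieModule.IsIrreducible ℝ 𝔨 𝔫)
    (hR : R ≤ 𝔫) (hR0 : R ≠ ⊥) : R = 𝔫 := by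
  have h := h𝔫.eq_bot_or_eq_top (R.comap 𝔫.incl)
  refine le_antisymm hR ?_
  rcases h with h | h
  · refine (hR0 ((LieSubmodule.eq_bot_iff _).2 fun x hx => ?_)).elim
    have h1 : (⟨x, hR hx⟩ : 𝔫) ∈ R.comap 𝔫.incl := hx
    rw [h, LieSubmodule.mem_bot] at h1
    exact congrArg Subtype.val h1
  · intro x hx
    have h1 : (⟨x, hx⟩ : 𝔫) ∈ R.comap 𝔫.incl := by rw [h]; trivial
    exact h1

variable [FiniteDimensional ℝ L] (hneg : ∀ X : L, X ≠ 0 → killingForm ℝ L X X < 0)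

/-- A trilinear form `([X, Y], Z)` vanishes on three real subspaces if and only if it vanishes on
their complexifications. -/
theorem exists_killingForm_lie_ne_zero_iff {N₁ N₂ N₃ : Submodule ℝ L} :
    (∃ X ∈ N₁, ∃ Y ∈ N₂, ∃ Z ∈ N₃, -killingForm ℝ L ⁅X, Y⁆ Z ≠ 0) ↔
      ∃ x ∈ N₁.baseChange ℂ, ∃ y ∈ N₂.baseChange ℂ, ∃ z ∈ N₃.baseChange ℂ,
        killingForm ℂ (ℂ ⊗[ℝ] L) ⁅x, y⁆ z ≠ 0 := by
  have key : ∀ X Y Z : L, killingForm ℂ (ℂ ⊗[ℝ] L) ⁅(1 : ℂ) ⊗ₜ[ℝ] X, (1 : ℂ) ⊗ₜ[ℝ] Y⁆ (1 ⊗ₜ Z) =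
      (killingForm ℝ L ⁅X, Y⁆ Z : ℂ) := fun X Y Z => by
    rw [lie_one_tmul, killingForm_tmul, one_mul, one_mul]
  constructor
  · rintro ⟨X, hX, Y, hY, Z, hZ, h⟩
    refine ⟨_, Submodule.tmul_mem_baseChange_of_mem 1 hX, _,
      Submodule.tmul_mem_baseChange_of_mem 1 hY, _, Submodule.tmul_mem_baseChange_of_mem 1 hZ, ?_⟩
    rw [key]
    exact_mod_cast neg_ne_zero.1 h
  · contrapose!
    intro h x hx y hy z hz
    have key' : ∀ X ∈ N₁, ∀ Y ∈ N₂, ∀ Z ∈ N₃,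
        killingForm ℂ (ℂ ⊗[ℝ] L) ⁅(1 : ℂ) ⊗ₜ[ℝ] X, (1 : ℂ) ⊗ₜ[ℝ] Y⁆ (1 ⊗ₜ Z) = 0 :=
      fun X hX Y hY Z hZ => by
        rw [key, neg_eq_zero.1 (h X hX Y hY Z hZ), Complex.ofReal_zero]
    obtain ⟨a, ha, b, hb, rfl⟩ := exists_of_mem_baseChange hx
    obtain ⟨a', ha', b', hb', rfl⟩ := exists_of_mem_baseChange hy
    obtain ⟨c, hc, d, hd, rfl⟩ := exists_of_mem_baseChange hz
    simp only [cx_add_lie, cx_lie_add, cx_smul_lie, cx_lie_smul, map_add, map_smul,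
      LinearMap.add_apply, LinearMap.smul_apply, key' _ ha _ ha' _ hc, key' _ ha _ ha' _ hd,
      key' _ ha _ hb' _ hc, key' _ ha _ hb' _ hd, key' _ hb _ ha' _ hc, key' _ hb _ ha' _ hd,
      key' _ hb _ hb' _ hc, key' _ hb _ hb' _ hd, smul_zero, add_zero]

variable (hC : ∀ X : L, (∀ H ∈ centre 𝔨, ⁅X, H⁆ = 0) → X ∈ 𝔨)
include hneg hC

/-- Correspondence with a `𝔱`-root expressed after complexification. -/
theorem corresponds_iff {ξ : centre 𝔨 →ₗ[ℝ] ℂ} {𝔫 : LieSubmodule ℝ 𝔨 L} :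
    Corresponds A ξ 𝔫 ↔ ξ ∈ tRoots A ∧ 𝔫.toSubmodule.baseChange ℂ =
      weightSpace (centre 𝔨) ξ ⊔ weightSpace (centre 𝔨) (-ξ : centre 𝔨 →ₗ[ℝ] ℂ) := by
  refine and_congr_right fun hξ => ?_
  have hξ0 := ((mem_tRoots_iff hneg hC).1 hξ).1
  rw [tRootModule_eq hneg hC hξ0, tRootModule_eq hneg hC (neg_ne_zero.2 hξ0)]
  constructor
  · intro h
    rw [h]
    refine baseChange_realPoints fun x hx => ?_
    obtain ⟨u, hu, v, hv, rfl⟩ := Submodule.mem_sup.1 hx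
    rw [map_add, add_comm]
    refine Submodule.add_mem_sup ?_ (conjugation_mem_weightSpace hneg hu)
    have := conjugation_mem_weightSpace hneg hv
    rwa [show -⇑(-ξ) = ⇑ξ from neg_neg (ξ : centre 𝔨 → ℂ)] at this
  · intro h
    rw [← h, realPoints_baseChange]

/-- The `𝔱`-roots corresponding to an irreducible summand of `𝔪` are `ξ` and `-ξ`, for any weight
`ξ` of `𝔱` on its complexification. -/
theorem exists_setOf_corresponds_eq {𝔫 : LieSubmodule ℝ 𝔨 L}
    (h𝔫 : LieModule.IsIrreducible ℝ 𝔨 𝔫) (hle : 𝔫.toSubmodule ≤ isotropySpace 𝔨) :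
    ∃ ξ ∈ tRoots A, {η | Corresponds A η 𝔫} = {ξ, -ξ} := by
  set N := 𝔫.toSubmodule.baseChange ℂ with hN
  have hNs : IsAdStable 𝔨 N := isAdStable_baseChange 𝔫
  have hN0 : N ≠ ⊥ := by
    have := LieModule.nontrivial_of_isIrreducible ℝ 𝔨 𝔫
    obtain ⟨⟨X, hX⟩, hX0⟩ := exists_ne (0 : 𝔫)
    refine (Submodule.ne_bot_iff _).2
      ⟨_, Submodule.tmul_mem_baseChange_of_mem 1 hX, fun h => hX0 ?_⟩
    exact Subtype.ext (tmul_one_injective (h.trans (TensorProduct.tmul_zero _ _).symm))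
  obtain ⟨ξ, hξ⟩ := exists_inf_weightSpace_ne_bot hneg centre_abelian N
    (fun H x hx => hNs H (mem_centre.1 H.2).1 x hx) hN0
  -- The zero weight space is `𝔨^ℂ`, which meets the complexification of `𝔪` only in `0`.
  have hξ0 : ξ ≠ 0 := by
    rintro rfl
    obtain ⟨x, ⟨hxN, hx⟩, hx0⟩ := (Submodule.ne_bot_iff _).1 hξ
    obtain ⟨a, ha, b, hb, rfl⟩ := exists_of_mem_baseChange hxN
    obtain ⟨ha', hb'⟩ := mem_of_mem_weightSpace_zero hC hx
    have key : ∀ c ∈ 𝔫, c ∈ 𝔨 → c = 0 := fun c hc hc' => by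
      by_contra h0
      exact (hneg c h0).ne (hle hc c hc')
    exact hx0 (by rw [key a ha ha', key b hb hb']; simp)
  have hsub : weightSpace (centre 𝔨) ξ ≤ N := by
    rw [← eq_weightSpace_of_isAdStable hneg hC (V := N ⊓ weightSpace (centre 𝔨) ξ)
      (fun k hk x hx => ⟨hNs k hk x hx.1, isAdStable_weightSpace _ k hk x hx.2⟩) hξ hξ0
      inf_le_right]
    exact inf_le_left
  have hsub' : weightSpace (centre 𝔨) (-ξ : centre 𝔨 →ₗ[ℝ] ℂ) ≤ N := fun x hx => by
    have h := conjugation_mem_weightSpace hneg hx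
    rw [show -⇑(-ξ) = ⇑ξ from neg_neg (ξ : centre 𝔨 → ℂ)] at h
    rw [← conjugation_conjugation x]
    exact conjugation_mem_baseChange (hsub h)
  have hξne := ne_bot_of_le_ne_bot hξ inf_le_right
  have hξt : ξ ∈ tRoots A := (mem_tRoots_iff hneg hC).2 ⟨hξ0, hξne⟩
  set U := weightSpace (centre 𝔨) ξ ⊔ weightSpace (centre 𝔨) (-ξ : centre 𝔨 →ₗ[ℝ] ℂ) with hU
  have hUs : IsAdStable 𝔨 U := (isAdStable_weightSpace _).sup (isAdStable_weightSpace _)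
  have hUτ : ∀ x ∈ U, τ x ∈ U := fun x hx => by
    obtain ⟨u, hu, v, hv, rfl⟩ := Submodule.mem_sup.1 hx
    rw [map_add, add_comm]
    refine Submodule.add_mem_sup ?_ (conjugation_mem_weightSpace hneg hu)
    have := conjugation_mem_weightSpace hneg hv
    rwa [show -⇑(-ξ) = ⇑ξ from neg_neg (ξ : centre 𝔨 → ℂ)] at this
  -- The real points of `U` form a nonzero submodule of the irreducible module `𝔫`.
  have hUN : N = U := by
    have hR : realSubmodule hUs = 𝔫 := by
      refine eq_of_le_of_isIrreducible h𝔫 (fun X hX => ?_) fun h0 => ?_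
      · exact tmul_mem_baseChange_iff.1 (sup_le hsub hsub' hX)
      · have h1 : realPoints U = ⊥ := congrArg LieSubmodule.toSubmodule h0
        have h2 := baseChange_realPoints hUτ
        rw [h1, Submodule.baseChange_bot] at h2
        exact hξne (eq_bot_iff.2 (h2 ▸ le_sup_left))
    rw [hN, ← hR]
    exact baseChange_realPoints hUτ
  refine ⟨ξ, hξt, Set.ext fun η => ?_⟩
  rw [Set.mem_ofPred_eq, corresponds_iff hneg hC, ← hN, hUN, Set.mem_insert_iff,
    Set.mem_singleton_iff]
  constructor
  · rintro ⟨hη, h⟩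
    obtain ⟨y, hy, hy0⟩ := (Submodule.ne_bot_iff _).1 ((mem_tRoots_iff hneg hC).1 hη).2
    have hyU : y ∈ U := by rw [h]; exact Submodule.mem_sup_left hy
    obtain ⟨u, hu, v, hv, huv⟩ := Submodule.mem_sup.1 hyU
    by_contra! hne
    refine hy0 (eq_zero_of_herm_self hneg y ?_)
    nth_rewrite 2 [← huv]
    rw [herm_add_right,
      herm_eq_zero_of_weight_ne hneg hy hu fun h' => hne.1 (DFunLike.coe_injective h'),
      herm_eq_zero_of_weight_ne hneg hy hv fun h' => hne.2 (DFunLike.coe_injective h'), add_zero]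
  · rintro (rfl | rfl)
    · exact ⟨hξt, rfl⟩
    · exact ⟨neg_mem_tRoots hneg hC hξt, by rw [neg_neg, hU, sup_comm]⟩

theorem Corresponds.neg {ξ : centre 𝔨 →ₗ[ℝ] ℂ} {𝔫 : LieSubmodule ℝ 𝔨 L}
    (h : Corresponds A ξ 𝔫) : Corresponds A (-ξ) 𝔫 := by
  refine ⟨neg_mem_tRoots hneg hC h.1, ?_⟩
  rw [neg_neg, sup_comm]
  exact h.2

theorem Corresponds.exists_weight_vector {ξ : centre 𝔨 →ₗ[ℝ] ℂ} {𝔫 : LieSubmodule ℝ 𝔨 L}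
    (h : Corresponds A ξ 𝔫) (f : ℂ ⊗[ℝ] L → ℂ) (hf : ∀ x y, f (x + y) = f x + f y)
    {x : ℂ ⊗[ℝ] L} (hx : x ∈ 𝔫.toSubmodule.baseChange ℂ) (hfx : f x ≠ 0) :
    ∃ η, Corresponds A η 𝔫 ∧ ∃ y ∈ weightSpace (centre 𝔨) η, f y ≠ 0 := by
  rw [((corresponds_iff hneg hC).1 h).2] at hx
  obtain ⟨u, hu, v, hv, rfl⟩ := Submodule.mem_sup.1 hx
  by_cases h0 : f u = 0
  · exact ⟨-ξ, h.neg hneg hC, v, hv, by rwa [hf, h0, zero_add] at hfx⟩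
  · exact ⟨ξ, h, u, hu, h0⟩

/-- The form `([X, Y], Z)` does not vanish on three summands of `𝔪` exactly when corresponding
`𝔱`-roots with sum zero exist: `𝔱`-invariance forces the weights to cancel, and conversely
`exists_killingForm_lie_ne_zero` applies. -/
theorem exists_killingForm_ne_zero_iff {𝔫₁ 𝔫₂ 𝔫₃ : LieSubmodule ℝ 𝔨 L}
    (h₁ : ∃ ξ, Corresponds A ξ 𝔫₁) (h₂ : ∃ ξ, Corresponds A ξ 𝔫₂) (h₃ : ∃ ξ, Corresponds A ξ 𝔫₃) :
    (∃ X ∈ 𝔫₁, ∃ Y ∈ 𝔫₂, ∃ Z ∈ 𝔫₃, -killingForm ℝ L ⁅X, Y⁆ Z ≠ 0) ↔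
      ∃ ξ η ζ, Corresponds A ξ 𝔫₁ ∧ Corresponds A η 𝔫₂ ∧ Corresponds A ζ 𝔫₃ ∧ ξ + η + ζ = 0 := by
  refine (exists_killingForm_lie_ne_zero_iff (N₁ := 𝔫₁.toSubmodule) (N₂ := 𝔫₂.toSubmodule)
    (N₃ := 𝔫₃.toSubmodule)).trans ⟨?_, ?_⟩
  · rintro ⟨x, hx, y, hy, z, hz, h⟩
    obtain ⟨_, h₁⟩ := h₁
    obtain ⟨_, h₂⟩ := h₂
    obtain ⟨_, h₃⟩ := h₃
    obtain ⟨ξ, hξ, x, hx, h⟩ := h₁.exists_weight_vector hneg hC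
      (fun x => killingForm ℂ (ℂ ⊗[ℝ] L) ⁅x, y⁆ z)
      (fun u v => by rw [cx_add_lie, map_add, LinearMap.add_apply]) hx h
    obtain ⟨η, hη, y, hy, h⟩ := h₂.exists_weight_vector hneg hC
      (fun y => killingForm ℂ (ℂ ⊗[ℝ] L) ⁅x, y⁆ z)
      (fun u v => by rw [cx_lie_add, map_add, LinearMap.add_apply]) hy h
    obtain ⟨ζ, hζ, z, hz, h⟩ := h₃.exists_weight_vector hneg hC
      (fun z => killingForm ℂ (ℂ ⊗[ℝ] L) ⁅x, y⁆ z) (fun u v => map_add _ u v) hz h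
    refine ⟨ξ, η, ζ, hξ, hη, hζ, ?_⟩
    by_contra hne
    have h1 := herm_eq_zero_of_weight_ne hneg
      (conjugation_mem_weightSpace hneg (lie_mem_weightSpace hx hy)) hz fun h' => hne ?_
    · rw [herm, conjugation_conjugation, neg_eq_zero] at h1
      exact h h1
    · rw [← neg_eq_iff_add_eq_zero]
      exact DFunLike.coe_injective h'
  · rintro ⟨ξ, η, ζ, hξ, hη, hζ, hsum⟩
    have ht : ∀ {ξ 𝔫}, Corresponds A ξ 𝔫 → weightSpace (centre 𝔨) ξ ≠ ⊥ ∧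
        weightSpace (centre 𝔨) ξ ≤ 𝔫.toSubmodule.baseChange ℂ := fun h => by
      refine ⟨((mem_tRoots_iff hneg hC).1 h.1).2, ?_⟩
      rw [((corresponds_iff hneg hC).1 h).2]
      exact le_sup_left
    obtain ⟨x, hx, y, hy, z, hz, h⟩ := exists_killingForm_lie_ne_zero hneg hC (ht hξ).1 (ht hη).1
      (ht hζ).1 ((mem_tRoots_iff hneg hC).1 hζ.1).1 hsum
    exact ⟨x, (ht hξ).2 hx, y, (ht hη).2 hy, z, (ht hζ).2 hz, h⟩

end

end FlagManifold

/-! ### The theorem for generalized flag manifolds -/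

theorem theoremA
    {E : Type*} [NormedAddCommGroup E] [NormedSpace ℝ E] [FiniteDimensional ℝ E] [CompleteSpace E]
    {G : Type*} [TopologicalSpace G] [ChartedSpace E G] [Group G] [LieGroup 𝓘(ℝ, E) ∞ G]
    [T2Space G] [CompactSpace G] [ConnectedSpace G]
    [LieAlgebra.IsSimple ℝ (GroupLieAlgebra 𝓘(ℝ, E) G)]
    (S K : Subgroup G) (hS : IsTorus (E := E) S) (hK : K = Subgroup.centralizer (S : Set G))
    (A : FlagManifold.MaximalAbelianIn (Subgroup.lieAlgebra (E := E) K))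
    (s : ℕ)
    (𝔪 : Fin s → LieSubmodule ℝ (Subgroup.lieAlgebra (E := E) K) (GroupLieAlgebra 𝓘(ℝ, E) G))
    (h𝔪 : FlagManifold.IsIsotropyDecomposition 𝔪) :
    (∀ i, ∃ ξ ∈ FlagManifold.tRoots A, {η | FlagManifold.Corresponds A η (𝔪 i)} = {ξ, -ξ}) ∧
    FlagManifold.deSiebenthal 𝔪 =
      {p | ∃ ξ η ζ, FlagManifold.Corresponds A ξ (𝔪 p.1) ∧
        FlagManifold.Corresponds A η (𝔪 p.2.1) ∧ FlagManifold.Corresponds A ζ (𝔪 p.2.2) ∧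
        ξ + η + ζ = 0} ∧
    (∀ P, FlagManifold.IsInvariantOrdering A P →
      ∀ ξ ∈ FlagManifold.tRoots A, ∀ η ∈ FlagManifold.tRoots A, ∀ ζ ∈ FlagManifold.tRoots A,
        ξ + η + ζ = 0 →
          ¬ (ξ ∈ FlagManifold.kappa A '' P ∧ η ∈ FlagManifold.kappa A '' P ∧
              ζ ∈ FlagManifold.kappa A '' P) ∧
          ¬ (ξ ∈ FlagManifold.kappa A '' (-P) ∧ η ∈ FlagManifold.kappa A '' (-P) ∧
              ζ ∈ FlagManifold.kappa A '' (-P))) := by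
  have hneg := killingForm_neg_of_compact (E := E) (G := G)
  have hC := mem_lieAlgebra_of_commute_centre hS hK
  have hle : ∀ i, (𝔪 i).toSubmodule ≤ FlagManifold.isotropySpace (Subgroup.lieAlgebra (E := E) K) :=
    fun i => h𝔪.iSup_eq ▸ le_iSup (fun i => (𝔪 i).toSubmodule) i
  have hcorr : ∀ i, ∃ ξ ∈ FlagManifold.tRoots A,
      {η | FlagManifold.Corresponds A η (𝔪 i)} = {ξ, -ξ} := fun i =>
    FlagManifold.exists_setOf_corresponds_eq hneg hC (h𝔪.irreducible i) (hle i)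
  have hex : ∀ i, ∃ ξ, FlagManifold.Corresponds A ξ (𝔪 i) := fun i => by
    obtain ⟨ξ, -, h⟩ := hcorr i
    exact ⟨ξ, h.ge (Set.mem_insert ξ {-ξ})⟩
  refine ⟨hcorr, Set.ext fun p => FlagManifold.exists_killingForm_ne_zero_iff hneg hC (hex p.1)
    (hex p.2.1) (hex p.2.2), fun P hP ξ _ η _ ζ _ hsum => ⟨fun h => ?_, fun h => ?_⟩⟩
  · exact FlagManifold.not_all_mem_ordering hneg hC hP h.1 h.2.1 h.2.2 hsum
  · have hn : ∀ {ξ}, ξ ∈ FlagManifold.kappa A '' (-P) → -ξ ∈ FlagManifold.kappa A '' P := by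
      rintro _ ⟨α, hα, rfl⟩
      exact ⟨-α, hα, rfl⟩
    refine FlagManifold.not_all_mem_ordering hneg hC hP (hn h.1) (hn h.2.1) (hn h.2.2) ?_
    rw [← neg_add, ← neg_add, hsum, neg_zero]

end
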